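/- **Setting.** Let $\mathcal D\subset\mathbb R^l$ be a compact convex set of test parameters. A true system $\dot x=f(x,u,d,w)$, $u=U(x,d)$, $w(t)\sim\pi(d)$, and a simulator $\dot{\hat x}=\hat f(\hat x,\hat u,d,\hat w)$, $\hat u=\hat U(\hat x,d)$, $\hat w(t)\sim\hat\pi(d)$, with common state and input spaces in $\mathbb R^n$ and $\mathbb R^m$, have for each $d\in\mathcal D$ random closed-loop trajectories $\phi\sim\Pi(d)$ and $\hat\phi\sim\hat\Pi(d)$ from fixed initial states, satisfying the integrated equations. Let $\rho$ be a real-valued robustness measure on signals (a specification holds for $s$ iff $\rho(s)\ge0$) with finite expectations $\mathbb E_{\Pi(d)}[\rho(\phi)]$ and $\mathbb E_{\hat\Pi(d)}[\rho(\hat\phi)]$ for all $d$. Put $\rho^*=\inf_{d\in\mathcal D}\mathbb E_{\Pi(d)}[\rho(\phi)]$, $\hat r(d)=\mathbb E_{\hat\Pi(d)}[\rho(\hat\phi)]$ and $g(d)=\mathbb E_{\Pi(d)\otimes\hat\Pi(d)}\big[|\rho(\phi)-\rho(\hat\phi)|\big]$. **Algorithm 1** for maximizing $J:\mathcal D\to\mathbb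 R$. Inputs: a measurable positive semidefinite kernel $k$ on $\mathcal D$, $B,R>0$, $\delta\in(0,1]$, a tolerance $\epsilon>0$ and regularization parameters $\lambda_i\ge1$ (for example $\lambda_i=1+2/i$). It starts from one sample $(z_0,y_0)$. In iteration $i=1,2,\dots$, from the $i$ samples $(z_j,y_j)$, $j<i$, with kernel matrix $K_i=(k(z_a,z_b))_{a,b<i}$, $k_i(z)=(k(z,z_j))_{j<i}$ and $y=(y_j)_{j<i}$, it forms $$\mu_{i-1}(z)=k_i(z)^T(K_i+\lambda_iI)^{-1}y,\qquad \sigma_{i-1}(z)^2=k(z,z)-k_i(z)^T(K_i+\lambda_iI)^{-1}k_i(z),$$ $$\beta_i=B+R\sqrt{2\ln\frac{\sqrt{\det((1+\frac2i)I+K_i)}}{\delta}},$$ chooses $z_i\in\arg\max_{z\in\mathcal D}\mu_{i-1}(z)+\beta_i\sigma_{i-1}(z)$ and measures $y_i$. If $2\beta_i\sigma_{i-1}(z_i)\le\epsilon$ it stops and outputs $J^e=\mu_{i-1}(z_i)+\beta_i\sigma_{i-1}(z_i)$; otherwise it continues. The measurements are $y_i=J(z_i)+\xi_i$ for all $i\ge0$,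 with $\xi_i$ being $R$-sub-Gaussian conditionally on $z_0,\dots,z_i,\xi_0,\dots,\xi_{i-1}$. **Theorem.** Run Algorithm 1 twice, independently: once for $J=-\hat r$ with inputs $(k_0,B_0,R_0,\delta_0,\epsilon_0)$ and once for $J=g$ with inputs $(k_1,B_1,R_1,\delta_1,\epsilon_1)$, where $-\hat r$ and $g$ lie in the reproducing kernel Hilbert spaces of $k_0$ and $k_1$ with norms at most $B_0$ and $B_1$. Let $\hat\rho^e$ be minus the output of the first run, $e^e$ the output of the second run, and $\rho^e=\hat\rho^e-e^e$. Then, at termination, $$\mathbb P[\rho^*\ge\rho^e]\ge(1-\delta_0)(1-\delta_1)\qquad\text{and}\qquad \mathbb P\big[|\rho^*-\rho^e|\le2e^e+\epsilon_0+\epsilon_1\big]\ge(1-\delta_0)(1-\delta_1);$$ precisely, in each case, with at least this probability the inequality holds or one of the runs does not terminate. Moreover, a run always terminates if its parameters $\lambda_i$ are bounded and the maximum information gain of its kernel satisfies $\gamma_j\le O(j^p\log j)$ for some $p<\frac12$; here $\gamma_j$ is the supremum over $j$ sample points of $\frac12\ln\det(I+s^{-1}K_j)$, for some fixed $s>0$.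 -/

import Mathlib

open MeasureTheory
open scoped NNReal

noncomputable section

namespace Sim2Real

/-! ### Kernels, RKHS balls and Gaussian-process regression -/

section GP

universe u

variable {X : Type u}

/-- `J` belongs to the reproducing kernel Hilbert space of `k` and its RKHS norm is at most `B`.
(A function space with kernel `k` exists exactly if `k` is symmetric and positive semidefinite, and
it is then unique, so the choice of `H` is immaterial.) -/
def RKHSNormLE (k : X → X → ℝ) (J : X → ℝ) (B : ℝ) : Prop :=
  ∃ (H : Type u) (_ : NormedAddCommGroup H) (_ : InnerProductSpace ℝ H) (_ : CompleteSpace H)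
    (_ : RKHS ℝ H X ℝ),
    (∀ x y, RKHS.kernel H x y 1 = k x y) ∧ ∃ f : H, (∀ x, f x = J x) ∧ ‖f‖ ≤ B

/-- The kernel matrix `K_n` of the points `x 0, …, x (n - 1)`. -/
def kernelMatrix (k : X → X → ℝ) {n : ℕ} (x : Fin n → X) : Matrix (Fin n) (Fin n) ℝ :=
  Matrix.of fun i j => k (x i) (x j)

/-- The vector `k_n(a) = [k(a, x 0), …, k(a, x (n - 1))]`. -/
def kernelVec (k : X → X → ℝ) {n : ℕ} (x : Fin n → X) (a : X) : Fin n → ℝ :=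
  fun i => k a (x i)

/-- Posterior mean `k_n(a)ᵀ (K_n + lam I)⁻¹ y`. -/
def postMean (k : X → X → ℝ) (lam : ℝ) {n : ℕ} (x : Fin n → X) (y : Fin n → ℝ) (a : X) : ℝ :=
  dotProduct (kernelVec k x a) (((kernelMatrix k x + lam • 1)⁻¹).mulVec y)

/-- Posterior covariance `k(a, b) - k_n(a)ᵀ (K_n + lam I)⁻¹ k_n(b)`. -/
def postCov (k : X → X → ℝ) (lam : ℝ) {n : ℕ} (x : Fin n → X) (a b : X) : ℝ :=
  k a b - dotProduct (kernelVec k x a) (((kernelMatrix k x + lam • 1)⁻¹).mulVec (kernelVec k x b))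

/-- Posterior standard deviation: the square root of the posterior variance. -/
def postStd (k : X → X → ℝ) (lam : ℝ) {n : ℕ} (x : Fin n → X) (a : X) : ℝ :=
  √(postCov k lam x a a)

/-- Information gain `I(y_A; J_A) = ½ log det (I + s⁻¹ K_A)` at the points `A = (x 0, …, x (n - 1))`:
the mutual information between the Gaussian vector `J_A ∼ N(0, K_A)` and its observation
`y_A = J_A + N(0, s I)`. -/
def infoGain (k : X → X → ℝ) (s : ℝ) {n : ℕ} (x : Fin n → X) : ℝ :=
  Real.log (1 + s⁻¹ • kernelMatrix k x).det / 2

/-- Maximum information gain `γ_n` over `n` sample points (repetitions allowed). -/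
def maxInfoGain (k : X → X → ℝ) (s : ℝ) (n : ℕ) : EReal :=
  ⨆ x : Fin n → X, (infoGain k s x : EReal)

/-- `γ_n ≤ O(n ^ p log n)` for some `p < 1 / 2`. -/
def InfoGainGrowth (k : X → X → ℝ) : Prop :=
  ∃ s : ℝ, 0 < s ∧ ∃ C p : ℝ, p < 1 / 2 ∧
    ∀ᶠ n : ℕ in Filter.atTop,
      maxInfoGain k s n ≤ ((C * ((n : ℝ) ^ p * Real.log n) : ℝ) : EReal)

end GP

/-! ### The modified GP-UCB algorithm -/

/-- Inputs of the algorithm on the decision space `X`: kernel, norm bound `B`, noise level `R`,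
failure probability `δ`, tolerance `ε`, and the regularization `reg i` of the Gaussian-process
regression used in iteration `i`. -/
structure Params (X : Type*) where
  k : X → X → ℝ
  B : ℝ
  R : ℝ
  δ : ℝ
  ε : ℝ
  reg : ℕ → ℝ
  B_pos : 0 < B
  R_pos : 0 < R
  δ_pos : 0 < δ
  δ_le_one : δ ≤ 1
  ε_pos : 0 < ε
  one_le_reg : ∀ i, 1 ≤ reg i

namespace Params

variable {X : Type*} (p : Params X)

/-! The data are `(z 0, y 0)` (the initial sample), `(z 1, y 1)`, …, so the data set `D_{i-1}`
available in iteration `i ≥ 1` consists of the `i` samples with index `j < i`. -/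

/-- Mean `μ_{i-1}` of the Gaussian process fitted to `D_{i-1}`. -/
def mean (z : ℕ → X) (y : ℕ → ℝ) (i : ℕ) (a : X) : ℝ :=
  postMean p.k (p.reg i) (fun j : Fin i => z j) (fun j : Fin i => y j) a

/-- Standard deviation `σ_{i-1}` of the Gaussian process fitted to `D_{i-1}`. -/
def std (z : ℕ → X) (i : ℕ) (a : X) : ℝ :=
  postStd p.k (p.reg i) (fun j : Fin i => z j) a

/-- Scale factor `β_i = B + R √(2 log (√det((1 + 2 / i) I + K_i) / δ))`. -/
def beta (z : ℕ → X) (i : ℕ) : ℝ :=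
  p.B + p.R * √(2 * Real.log
    (√((1 + 2 / (i : ℝ)) • 1 + kernelMatrix p.k (fun j : Fin i => z j)).det / p.δ))

/-- UCB acquisition function `μ_{i-1} + β_i σ_{i-1}`. -/
def ucb (z : ℕ → X) (y : ℕ → ℝ) (i : ℕ) (a : X) : ℝ :=
  p.mean z y i a + p.beta z i * p.std z i a

/-- Simple regret bound `F_i = 2 β_i σ_{i-1}(z_i)`. -/
def regretBound (z : ℕ → X) (i : ℕ) : ℝ :=
  2 * p.beta z i * p.std z i (z i)

end Params

/-- Everything known just before the noise `ξ t` is drawn: the σ-algebra generated by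
`z 0, …, z t` and `ξ 0, …, ξ (t - 1)`. -/
abbrev history {X Ω : Type*} [MeasurableSpace X] (z : ℕ → Ω → X) (ξ : ℕ → Ω → ℝ) (t : ℕ) :
    MeasurableSpace Ω :=
  (⨆ (j : ℕ) (_ : j ≤ t), MeasurableSpace.comap (z j) inferInstance) ⊔
    ⨆ (j : ℕ) (_ : j < t), MeasurableSpace.comap (ξ j) inferInstance

/-- Each `ξ t` is `R`-sub-Gaussian conditionally on the history. -/
def SubGaussianNoise {X Ω : Type*} [MeasurableSpace X] [MeasurableSpace Ω] (P : Measure Ω)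
    (z : ℕ → Ω → X) (ξ : ℕ → Ω → ℝ) (R : ℝ) : Prop :=
  ∀ (t : ℕ) (s : ℝ), Integrable (fun ω => Real.exp (s * ξ t ω)) P ∧
    P[fun ω => Real.exp (s * ξ t ω) | history z ξ t] ≤ᵐ[P] fun _ => Real.exp (s ^ 2 * R ^ 2 / 2)

/-- A (random) run of the algorithm with inputs `p` for the maximization of `J`.
The initial point `z 0` is arbitrary. From iteration `1` on, as long as the stopping test has not
succeeded in an earlier iteration, the next point maximizes the acquisition function over the whole
decision space. After termination the sequences carry no information. -/
structure Run {X Ω : Type*} [MeasurableSpace X] [MeasurableSpace Ω] (p : Params X) (J : X → ℝ)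
    (P : Measure Ω) where
  /-- sample points -/
  z : ℕ → Ω → X
  /-- measurement noise -/
  ξ : ℕ → Ω → ℝ
  measurable_z : ∀ i, Measurable (z i)
  measurable_ξ : ∀ i, Measurable (ξ i)
  subGaussian : SubGaussianNoise P z ξ p.R
  isMax : ∀ᵐ ω ∂P, ∀ i : ℕ, 1 ≤ i →
    (∀ j : ℕ, 1 ≤ j → j < i → p.ε < p.regretBound (fun n => z n ω) j) →
    ∀ a : X,
      p.ucb (fun n => z n ω) (fun n => J (z n ω) + ξ n ω) i a ≤
        p.ucb (fun n => z n ω) (fun n => J (z n ω) + ξ n ω) i (z i ω)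

namespace Run

variable {X Ω : Type*} [MeasurableSpace X] [MeasurableSpace Ω] {p : Params X} {J : X → ℝ}
  {P : Measure Ω} (r : Run p J P)

/-- The sequence of sampled points. -/
def points (ω : Ω) (i : ℕ) : X := r.z i ω

/-- The noisy measurements `y_i = J(z_i) + ξ_i`. -/
def meas (ω : Ω) (i : ℕ) : ℝ := J (r.z i ω) + r.ξ i ω

/-- The stopping test succeeds in some iteration. -/
def Terminates (ω : Ω) : Prop := ∃ i : ℕ, 1 ≤ i ∧ p.regretBound (r.points ω) i ≤ p.ε

/-- The iteration in which the algorithm stops: the first one in which the test succeeds. -/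
def stopIter (ω : Ω) : ℕ := sInf {i : ℕ | 1 ≤ i ∧ p.regretBound (r.points ω) i ≤ p.ε}

/-- The output `J^e`: the maximum of the acquisition function in the last iteration. -/
def output (ω : Ω) : ℝ :=
  p.ucb (r.points ω) (r.meas ω) (r.stopIter ω) (r.points ω (r.stopIter ω))

end Run

/-! ### The true system, the simulator and robustness -/

/-- A control system `x' = f(x, u, d, w)`, `u = U(x, d)`, with test parameter `d ∈ 𝒟` and random
disturbance `w ∼ noise d`. -/
structure ControlSystem {n m l : ℕ} (𝒳 : Set (EuclideanSpace ℝ (Fin n)))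
    (𝒰 : Set (EuclideanSpace ℝ (Fin m))) (𝒟 : Set (EuclideanSpace ℝ (Fin l)))
    (W : Type*) [MeasurableSpace W] where
  f : EuclideanSpace ℝ (Fin n) → EuclideanSpace ℝ (Fin m) → 𝒟 → W → EuclideanSpace ℝ (Fin n)
  U : EuclideanSpace ℝ (Fin n) → 𝒟 → EuclideanSpace ℝ (Fin m)
  U_mem : ∀ x ∈ 𝒳, ∀ d, U x d ∈ 𝒰
  noise : 𝒟 → Measure W
  isProb_noise : ∀ d, IsProbabilityMeasure (noise d)

/-- The random closed-loop trajectories of a control system from the initial state `x₀`. For each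
test `d` the trajectory is a random signal on the probability space `(Θ, law d)`; its distribution
is the trajectory distribution `Π(d)`. -/
structure ClosedLoop {n m l : ℕ} {𝒳 : Set (EuclideanSpace ℝ (Fin n))}
    {𝒰 : Set (EuclideanSpace ℝ (Fin m))} {𝒟 : Set (EuclideanSpace ℝ (Fin l))}
    {W : Type*} [MeasurableSpace W] (S : ControlSystem 𝒳 𝒰 𝒟 W) (x₀ : EuclideanSpace ℝ (Fin n))
    (Θ : Type*) [MeasurableSpace Θ] where
  law : 𝒟 → Measure Θ
  isProb_law : ∀ d, IsProbabilityMeasure (law d)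
  /-- disturbance signal -/
  w : 𝒟 → ℝ≥0 → Θ → W
  measurable_w : ∀ d t, Measurable (w d t)
  map_w : ∀ d t, (law d).map (w d t) = S.noise d
  /-- state trajectory -/
  φ : 𝒟 → Θ → ℝ≥0 → EuclideanSpace ℝ (Fin n)
  measurable_φ : ∀ d t, Measurable fun θ => φ d θ t
  φ_mem : ∀ d, ∀ᵐ θ ∂law d, ∀ t, φ d θ t ∈ 𝒳
  solves : ∀ d, ∀ᵐ θ ∂law d, ∀ t : ℝ≥0,
    IntervalIntegrable (fun s : ℝ => S.f (φ d θ s.toNNReal) (S.U (φ d θ s.toNNReal) d) d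
      (w d s.toNNReal θ)) volume 0 t ∧
    φ d θ t = x₀ + ∫ s in (0 : ℝ)..t, S.f (φ d θ s.toNNReal) (S.U (φ d θ s.toNNReal) d) d
      (w d s.toNNReal θ)

/-- `ρ` is a robustness measure for the specification `ψ`. -/
def IsRobustnessMeasure {n : ℕ} (ψ : (ℝ≥0 → EuclideanSpace ℝ (Fin n)) → Prop)
    (ρ : (ℝ≥0 → EuclideanSpace ℝ (Fin n)) → ℝ) : Prop :=
  ∀ s, ψ s ↔ 0 ≤ ρ s

section Robustness

variable {n m l : ℕ} {𝒳 : Set (EuclideanSpace ℝ (Fin n))}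
  {𝒰 : Set (EuclideanSpace ℝ (Fin m))} {𝒟 : Set (EuclideanSpace ℝ (Fin l))}
  {W W' : Type*} [MeasurableSpace W] [MeasurableSpace W']
  {S : ControlSystem 𝒳 𝒰 𝒟 W} {S' : ControlSystem 𝒳 𝒰 𝒟 W'}
  {x₀ x₀' : EuclideanSpace ℝ (Fin n)}
  {Θ Θ' : Type*} [MeasurableSpace Θ] [MeasurableSpace Θ']

/-- The robustness of the random trajectory has an expected value in every test. -/
def HasExpectedRobustness (ρ : (ℝ≥0 → EuclideanSpace ℝ (Fin n)) → ℝ) (C : ClosedLoop S x₀ Θ) :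
    Prop :=
  ∀ d, Integrable (fun θ => ρ (C.φ d θ)) (C.law d)

/-- Expected robustness in test `d`. -/
def expRobustness (ρ : (ℝ≥0 → EuclideanSpace ℝ (Fin n)) → ℝ) (C : ClosedLoop S x₀ Θ) (d : 𝒟) : ℝ :=
  ∫ θ, ρ (C.φ d θ) ∂C.law d

/-- Minimum (infimum) over all tests of the expected robustness. -/
def minExpRobustness (ρ : (ℝ≥0 → EuclideanSpace ℝ (Fin n)) → ℝ) (C : ClosedLoop S x₀ Θ) : ℝ :=
  ⨅ d, expRobustness ρ C d

/-- Expected Sim2Real robustness gap in test `d`: the expectation of the absolute difference of the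
robustness of independent trajectories of the two systems. -/
def expGap (ρ : (ℝ≥0 → EuclideanSpace ℝ (Fin n)) → ℝ) (C : ClosedLoop S x₀ Θ)
    (C' : ClosedLoop S' x₀' Θ') (d : 𝒟) : ℝ :=
  ∫ q, |ρ (C.φ d q.1) - ρ (C'.φ d q.2)| ∂(C.law d).prod (C'.law d)

end Robustness

end Sim2Real

end

namespace Sim2Real

open Matrix ProbabilityTheory
open scoped ENNReal

universe u

/-! Write `k x y` as an inner product of features `Φ x`, `Φ y`, and `J` as pairing with a vector
`f`. Gaussian-process regression is then ridge regression: the posterior variance is the minimum of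
a regularized residual, and Cauchy–Schwarz bounds the error of the posterior mean by `(‖f‖ +
√noiseEnergy)` times the posterior deviation (`abs_sub_postMean_le`).

The noise is controlled at all times at once. Averaging the exponential supermartingales of
sub-Gaussian noise over a Gaussian process yields `selfNormalized`, a nonnegative supermartingale
starting at 1. By Ville's inequality it stays below `1 / δ` with probability at least `1 - δ`, and
then `noiseEnergy` is at most the log-determinant expression in `beta`. A bound uniform in time is
needed because the stopping iteration is random.

On this event the acquisition function dominates `J`, so its maximum does too; at the maximizer it
exceeds `J` by at most the regret bound, hence by at most `ε` on stopping (`Run.output_spec`).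

Termination is deterministic. Were the regret bound always above `ε`, every posterior variance would
be at least of order `i ^ (-q)` with `q < 1 / 2`. By the chain rule the information gain would grow
at least like `T ^ (1 - q)`, yet it is at most of order `T ^ q` (`Params.exists_regretBound_le`).

Finally, the two expected robustness values differ by at most `expGap`, so correct outputs of both
runs enclose the true minimum; independence multiplies the probabilities. -/

theorem RKHSNormLE.exists_featureMap {X : Type u} {k : X → X → ℝ} {J : X → ℝ} {B : ℝ}
    (h : RKHSNormLE k J B) :
    ∃ (H : Type u) (_ : NormedAddCommGroup H) (_ : InnerProductSpace ℝ H) (Φ : X → H),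
      (∀ x y, k x y = inner ℝ (Φ x) (Φ y)) ∧
        ∃ f : H, (∀ x, J x = inner ℝ f (Φ x)) ∧ ‖f‖ ≤ B := by
  obtain ⟨H, i1, i2, i3, i4, hk, f, hf, hB⟩ := h
  refine ⟨H, i1, i2, fun x => RKHS.kerFun H x (1 : ℝ), fun x y => ?_, f, fun x => ?_, hB⟩
  · rw [← hk, RKHS.kerFun_inner, RKHS.kerFun_apply]
    simp
  · rw [RKHS.inner_kerFun, hf]
    simp

/-! ### Posterior variance as a ridge-regression residual -/

section FeatureMap

variable {X H : Type*} [NormedAddCommGroup H] [InnerProductSpace ℝ H]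
  {k : X → X → ℝ} {Φ : X → H}

theorem dotProduct_kernelMatrix_mulVec (hk : ∀ x y, k x y = inner ℝ (Φ x) (Φ y)) {n : ℕ}
    (x : Fin n → X) (u v : Fin n → ℝ) :
    u ⬝ᵥ (kernelMatrix k x *ᵥ v) = inner ℝ (∑ i, u i • Φ (x i)) (∑ j, v j • Φ (x j)) := by
  rw [sum_inner]
  refine Finset.sum_congr rfl fun i _ => ?_
  rw [inner_smul_left, inner_sum]
  simp [mulVec, dotProduct, kernelMatrix, hk, inner_smul_right, mul_comm]

theorem dotProduct_kernelVec (hk : ∀ x y, k x y = inner ℝ (Φ x) (Φ y)) {n : ℕ}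
    (x : Fin n → X) (a : X) (v : Fin n → ℝ) :
    kernelVec k x a ⬝ᵥ v = inner ℝ (Φ a) (∑ j, v j • Φ (x j)) := by
  simp only [dotProduct, kernelVec, inner_sum, inner_smul_right, hk]
  exact Finset.sum_congr rfl fun i _ => mul_comm _ _

theorem posDef_kernelMatrix_add_smul_one (hk : ∀ x y, k x y = inner ℝ (Φ x) (Φ y)) {n : ℕ}
    (x : Fin n → X) {lam : ℝ} (hlam : 0 < lam) : (kernelMatrix k x + lam • 1).PosDef := by
  refine Matrix.PosDef.posSemidef_add ?_ (Matrix.PosDef.one.smul hlam)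
  refine Matrix.PosSemidef.of_dotProduct_mulVec_nonneg ?_ fun v => ?_
  · ext i j
    simp [kernelMatrix, hk, real_inner_comm]
  · rw [star_trivial, dotProduct_kernelMatrix_mulVec hk]
    exact real_inner_self_nonneg

theorem isUnit_det_kernelMatrix_add (hk : ∀ x y, k x y = inner ℝ (Φ x) (Φ y)) {n : ℕ}
    (x : Fin n → X) {lam : ℝ} (hlam : 0 < lam) : IsUnit (kernelMatrix k x + lam • 1).det :=
  (posDef_kernelMatrix_add_smul_one hk x hlam).det_pos.ne'.isUnit

/-- The defining linear system of `v = (K + lam I)⁻¹ y`. -/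
theorem kernelMatrix_mulVec_inv_add (hk : ∀ x y, k x y = inner ℝ (Φ x) (Φ y)) {n : ℕ}
    (x : Fin n → X) {lam : ℝ} (hlam : 0 < lam) (y : Fin n → ℝ) :
    kernelMatrix k x *ᵥ ((kernelMatrix k x + lam • 1)⁻¹ *ᵥ y) +
      lam • ((kernelMatrix k x + lam • 1)⁻¹ *ᵥ y) = y := by
  have h : (kernelMatrix k x + lam • 1) *ᵥ ((kernelMatrix k x + lam • 1)⁻¹ *ᵥ y) = y := by
    rw [mulVec_mulVec, mul_nonsing_inv _ (isUnit_det_kernelMatrix_add hk x hlam), one_mulVec]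
  rwa [add_mulVec, smul_mulVec, one_mulVec] at h

theorem inv_mulVec_eq (hk : ∀ x y, k x y = inner ℝ (Φ x) (Φ y)) {n : ℕ}
    (x : Fin n → X) {lam : ℝ} (hlam : 0 < lam) {u y : Fin n → ℝ}
    (h : kernelMatrix k x *ᵥ u + lam • u = y) : (kernelMatrix k x + lam • 1)⁻¹ *ᵥ y = u := by
  have h1 : (kernelMatrix k x + lam • 1) *ᵥ u = y := by
    rw [add_mulVec, smul_mulVec, one_mulVec, h]
  rw [← h1, mulVec_mulVec, nonsing_inv_mul _ (isUnit_det_kernelMatrix_add hk x hlam), one_mulVec]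

/-- The expansion of `‖Φ a - ∑ v j Φ (x j)‖² + lam |v|²`. -/
theorem regularized_residual (hk : ∀ x y, k x y = inner ℝ (Φ x) (Φ y)) {n : ℕ}
    (x : Fin n → X) (lam : ℝ) (a : X) (v : Fin n → ℝ) :
    ‖Φ a - ∑ j, v j • Φ (x j)‖ ^ 2 + lam * (v ⬝ᵥ v) =
      k a a - 2 * (kernelVec k x a ⬝ᵥ v) + v ⬝ᵥ (kernelMatrix k x *ᵥ v + lam • v) := by
  rw [@norm_sub_sq_real, dotProduct_add, dotProduct_kernelMatrix_mulVec hk,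
    dotProduct_kernelVec hk, hk, real_inner_self_eq_norm_sq, real_inner_self_eq_norm_sq,
    dotProduct_smul, smul_eq_mul]
  ring

/-- The weights `v` solve the normal equations, so the quadratic term in `regularized_residual`
collapses to `v ⬝ᵥ kernelVec k x a` and cancels half of the cross term. -/
theorem postCov_self_eq (hk : ∀ x y, k x y = inner ℝ (Φ x) (Φ y)) {n : ℕ}
    (x : Fin n → X) {lam : ℝ} (hlam : 0 < lam) (a : X) {v : Fin n → ℝ}
    (hv : v = (kernelMatrix k x + lam • 1)⁻¹ *ᵥ kernelVec k x a) :
    postCov k lam x a a = ‖Φ a - ∑ j, v j • Φ (x j)‖ ^ 2 + lam * (v ⬝ᵥ v) := by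
  rw [regularized_residual hk, hv, kernelMatrix_mulVec_inv_add hk x hlam,
    dotProduct_comm _ (kernelVec k x a), postCov]
  ring

theorem postCov_self_nonneg (hk : ∀ x y, k x y = inner ℝ (Φ x) (Φ y)) {n : ℕ}
    (x : Fin n → X) {lam : ℝ} (hlam : 0 < lam) (a : X) : 0 ≤ postCov k lam x a a := by
  rw [postCov_self_eq hk x hlam a rfl]
  have := dotProduct_self_star_nonneg ((kernelMatrix k x + lam • 1)⁻¹ *ᵥ kernelVec k x a)
  rw [star_trivial] at this
  positivity

/-- The posterior variance is the minimum of the regularized residual. -/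
theorem postCov_self_le (hk : ∀ x y, k x y = inner ℝ (Φ x) (Φ y)) {n : ℕ}
    (x : Fin n → X) {lam : ℝ} (hlam : 0 < lam) (a : X) (v : Fin n → ℝ) :
    postCov k lam x a a ≤ ‖Φ a - ∑ j, v j • Φ (x j)‖ ^ 2 + lam * (v ⬝ᵥ v) := by
  set u := (kernelMatrix k x + lam • 1)⁻¹ *ᵥ kernelVec k x a with hu
  have h1 := kernelMatrix_mulVec_inv_add hk x hlam (kernelVec k x a)
  rw [← hu] at h1
  have h2 := postCov_self_eq hk x hlam a hu
  -- The residual at `v` exceeds the one at the stationary point `u` by exactly this nonnegative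
  -- quadratic form in `v - u`.
  have h3 : (0 : ℝ) ≤ (v - u) ⬝ᵥ (kernelMatrix k x *ᵥ (v - u) + lam • (v - u)) := by
    rw [dotProduct_add, dotProduct_kernelMatrix_mulVec hk, dotProduct_smul, smul_eq_mul]
    have := dotProduct_self_star_nonneg (v - u)
    rw [star_trivial] at this
    have := real_inner_self_nonneg (F := H) (x := ∑ i, (v - u) i • Φ (x i))
    positivity
  have h4 : u ⬝ᵥ (kernelMatrix k x *ᵥ v + lam • v) = kernelVec k x a ⬝ᵥ v := by
    rw [← h1, dotProduct_add, add_dotProduct, dotProduct_comm (kernelMatrix k x *ᵥ u),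
      dotProduct_kernelMatrix_mulVec hk, dotProduct_kernelMatrix_mulVec hk, real_inner_comm]
    simp
  rw [h2, regularized_residual hk, regularized_residual hk, h1]
  have h5 : (v - u) ⬝ᵥ (kernelMatrix k x *ᵥ (v - u) + lam • (v - u)) =
      v ⬝ᵥ (kernelMatrix k x *ᵥ v + lam • v) - u ⬝ᵥ (kernelMatrix k x *ᵥ v + lam • v)
        - v ⬝ᵥ kernelVec k x a + u ⬝ᵥ kernelVec k x a := by
    rw [← h1]
    simp only [mulVec_sub, smul_sub, sub_dotProduct, dotProduct_sub, dotProduct_add]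
    ring
  rw [h5, h4] at h3
  rw [dotProduct_comm u] at h3 ⊢
  rw [dotProduct_comm v (kernelVec k x a)] at h3
  linarith

/-- The minimizer for `lam'` is a competitor in the minimization for `lam`, where its penalty is no
larger. -/
theorem postCov_self_mono (hk : ∀ x y, k x y = inner ℝ (Φ x) (Φ y)) {n : ℕ}
    (x : Fin n → X) {lam lam' : ℝ} (hlam : 0 < lam) (h : lam ≤ lam') (a : X) :
    postCov k lam x a a ≤ postCov k lam' x a a := by
  rw [postCov_self_eq hk x (hlam.trans_le h) a rfl]
  refine (postCov_self_le hk x hlam a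
    ((kernelMatrix k x + lam' • 1)⁻¹ *ᵥ kernelVec k x a)).trans ?_
  have := dotProduct_self_star_nonneg ((kernelMatrix k x + lam' • 1)⁻¹ *ᵥ kernelVec k x a)
  rw [star_trivial] at this
  gcongr

/-- After division by the regularization the weight sits on the residual instead of the penalty, so
the same competitor argument runs in the opposite direction. -/
theorem inv_mul_postCov_self_antitone (hk : ∀ x y, k x y = inner ℝ (Φ x) (Φ y)) {n : ℕ}
    (x : Fin n → X) {lam lam' : ℝ} (hlam : 0 < lam) (h : lam ≤ lam') (a : X) :
    lam'⁻¹ * postCov k lam' x a a ≤ lam⁻¹ * postCov k lam x a a := by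
  have hlam' := hlam.trans_le h
  rw [postCov_self_eq hk x hlam a rfl]
  set v := (kernelMatrix k x + lam • 1)⁻¹ *ᵥ kernelVec k x a
  have h1 := postCov_self_le hk x hlam' a v
  have h2 : lam'⁻¹ ≤ lam⁻¹ := inv_anti₀ hlam h
  calc lam'⁻¹ * postCov k lam' x a a
      ≤ lam'⁻¹ * (‖Φ a - ∑ j, v j • Φ (x j)‖ ^ 2 + lam' * (v ⬝ᵥ v)) := by gcongr
    _ = lam'⁻¹ * ‖Φ a - ∑ j, v j • Φ (x j)‖ ^ 2 + v ⬝ᵥ v := by field_simp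
    _ ≤ lam⁻¹ * ‖Φ a - ∑ j, v j • Φ (x j)‖ ^ 2 + v ⬝ᵥ v := by gcongr
    _ = _ := by field_simp

end FeatureMap

/-! ### Effect of the noise on the regression, and updates by one sample -/

/-- The quadratic form `eᵀ K (K + I)⁻¹ e`. -/
noncomputable def noiseEnergy {X : Type*} (k : X → X → ℝ) {n : ℕ} (x : Fin n → X)
    (e : Fin n → ℝ) : ℝ :=
  e ⬝ᵥ e - e ⬝ᵥ ((kernelMatrix k x + (1 : ℝ) • 1)⁻¹ *ᵥ e)

section FeatureMap

variable {X H : Type*} [NormedAddCommGroup H] [InnerProductSpace ℝ H]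
  {k : X → X → ℝ} {Φ : X → H}

/-- Substituting `e = K u + u` gives `eᵀ e - eᵀ u = eᵀ K u = |K u|² + uᵀ K u`. This sum of squares
has the shape needed for Cauchy–Schwarz against the posterior variance. -/
theorem noiseEnergy_eq (hk : ∀ x y, k x y = inner ℝ (Φ x) (Φ y)) {n : ℕ} (x : Fin n → X)
    {e u : Fin n → ℝ} (hu : u = (kernelMatrix k x + (1 : ℝ) • 1)⁻¹ *ᵥ e) :
    noiseEnergy k x e =
      (kernelMatrix k x *ᵥ u) ⬝ᵥ (kernelMatrix k x *ᵥ u) + ‖∑ j, u j • Φ (x j)‖ ^ 2 := by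
  have h1 := kernelMatrix_mulVec_inv_add hk x one_pos e
  rw [← hu, one_smul] at h1
  rw [noiseEnergy, ← hu, ← real_inner_self_eq_norm_sq, ← dotProduct_kernelMatrix_mulVec hk, ← h1]
  simp only [add_dotProduct, dotProduct_add, dotProduct_comm _ u]
  ring

/-- With `v` the ridge weights, the left side is `(v ⬝ᵥ e)²`. Splitting `e = K u + u` pairs `v` with
`K u` and, up to the factor `lam`, the residual `w` with `∑ u j Φ (x j)`; Cauchy–Schwarz on the pair
concludes. Since `lam ≥ 1`, the noise can be measured with regularization 1 while the regression
uses `lam`. -/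
theorem sq_kernelVec_dotProduct_inv_mulVec_le (hk : ∀ x y, k x y = inner ℝ (Φ x) (Φ y)) {n : ℕ}
    (x : Fin n → X) {lam : ℝ} (hlam : 1 ≤ lam) (a : X) (e : Fin n → ℝ) :
    (kernelVec k x a ⬝ᵥ ((kernelMatrix k x + lam • 1)⁻¹ *ᵥ e)) ^ 2 ≤
      postCov k lam x a a * noiseEnergy k x e := by
  have hlam0 : 0 < lam := one_pos.trans_le hlam
  set v := (kernelMatrix k x + lam • 1)⁻¹ *ᵥ kernelVec k x a with hv
  set u := (kernelMatrix k x + (1 : ℝ) • 1)⁻¹ *ᵥ e with hu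
  have hve := kernelMatrix_mulVec_inv_add hk x hlam0 (kernelVec k x a)
  rw [← hv] at hve
  have hue := kernelMatrix_mulVec_inv_add hk x one_pos e
  rw [← hu, one_smul] at hue
  set w := Φ a - ∑ j, v j • Φ (x j) with hw
  have hsymm : kernelVec k x a ⬝ᵥ ((kernelMatrix k x + lam • 1)⁻¹ *ᵥ e) = v ⬝ᵥ e := by
    have hT : ((kernelMatrix k x + lam • 1)⁻¹)ᵀ = (kernelMatrix k x + lam • 1)⁻¹ := by
      have := (posDef_kernelMatrix_add_smul_one hk x hlam0).isHermitian.inv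
      simpa [Matrix.IsHermitian, conjTranspose_eq_transpose_of_trivial] using this
    rw [dotProduct_mulVec, ← mulVec_transpose, hT]
  -- The normal equations for `v` say that the residual has inner product `lam * v j` with the
  -- feature of `x j`.
  have hvu : lam * (v ⬝ᵥ u) = inner ℝ w (∑ j, u j • Φ (x j)) := by
    rw [hw, inner_sub_left, ← dotProduct_kernelVec hk, ← dotProduct_kernelMatrix_mulVec hk,
      ← hve, add_dotProduct, smul_dotProduct, smul_eq_mul,
      dotProduct_comm (kernelMatrix k x *ᵥ v), dotProduct_kernelMatrix_mulVec hk,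
      dotProduct_kernelMatrix_mulVec hk, real_inner_comm]
    ring
  rw [hsymm, postCov_self_eq hk x hlam0 a hv, noiseEnergy_eq hk x hu, ← hw]
  have hsplit : v ⬝ᵥ e = v ⬝ᵥ (kernelMatrix k x *ᵥ u) + v ⬝ᵥ u := by
    conv_lhs => rw [← hue, dotProduct_add]
  set c := kernelMatrix k x *ᵥ u
  set p := ∑ j, u j • Φ (x j)
  have hcs1 : (v ⬝ᵥ c) ^ 2 ≤ (v ⬝ᵥ v) * (c ⬝ᵥ c) := by
    have := Finset.sum_mul_sq_le_sq_mul_sq Finset.univ v c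
    simpa [dotProduct, pow_two] using this
  have hcs2 : (inner ℝ w p) ^ 2 ≤ ‖w‖ ^ 2 * ‖p‖ ^ 2 := by
    rw [← mul_pow, ← sq_abs]
    exact pow_le_pow_left₀ (abs_nonneg _) (abs_real_inner_le_norm w p) 2
  have hvv : 0 ≤ v ⬝ᵥ v := by simpa using dotProduct_self_star_nonneg v
  have hcc : 0 ≤ c ⬝ᵥ c := by simpa using dotProduct_self_star_nonneg c
  have hvu' : (v ⬝ᵥ u) ^ 2 ≤ ‖w‖ ^ 2 * ‖p‖ ^ 2 := by
    refine le_trans ?_ hcs2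
    rw [← hvu, mul_pow]
    exact le_mul_of_one_le_left (sq_nonneg _) (one_le_pow₀ hlam)
  have hcross : 2 * ((v ⬝ᵥ c) * (v ⬝ᵥ u)) ≤ (v ⬝ᵥ v) * ‖p‖ ^ 2 + ‖w‖ ^ 2 * (c ⬝ᵥ c) := by
    have hA : 0 ≤ (v ⬝ᵥ v) * ‖p‖ ^ 2 := by positivity
    have hB : 0 ≤ ‖w‖ ^ 2 * (c ⬝ᵥ c) := by positivity
    have h : ((v ⬝ᵥ c) * (v ⬝ᵥ u)) ^ 2 ≤ ((v ⬝ᵥ v) * ‖p‖ ^ 2) * (‖w‖ ^ 2 * (c ⬝ᵥ c)) := by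
      rw [mul_pow]
      calc _ ≤ ((v ⬝ᵥ v) * (c ⬝ᵥ c)) * (‖w‖ ^ 2 * ‖p‖ ^ 2) := by gcongr
        _ = _ := by ring
    refine le_of_sq_le_sq ?_ (by positivity)
    nlinarith [sq_nonneg ((v ⬝ᵥ v) * ‖p‖ ^ 2 - ‖w‖ ^ 2 * (c ⬝ᵥ c))]
  rw [hsplit]
  calc (v ⬝ᵥ c + v ⬝ᵥ u) ^ 2
      = (v ⬝ᵥ c) ^ 2 + 2 * ((v ⬝ᵥ c) * (v ⬝ᵥ u)) + (v ⬝ᵥ u) ^ 2 := by ring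
    _ ≤ (‖w‖ ^ 2 + v ⬝ᵥ v) * (c ⬝ᵥ c + ‖p‖ ^ 2) := by nlinarith
    _ ≤ (‖w‖ ^ 2 + lam * (v ⬝ᵥ v)) * (c ⬝ᵥ c + ‖p‖ ^ 2) := by
        gcongr
        exact le_mul_of_one_le_left hvv hlam

/-- Deterministic confidence bound for Gaussian-process regression with an RKHS function. -/
theorem abs_sub_postMean_le (hk : ∀ x y, k x y = inner ℝ (Φ x) (Φ y)) {J : X → ℝ} {f : H}
    (hf : ∀ x, J x = inner ℝ f (Φ x)) {B : ℝ} (hB : ‖f‖ ≤ B) {n : ℕ}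
    (x : Fin n → X) {lam : ℝ} (hlam : 1 ≤ lam) (a : X) (e : Fin n → ℝ) :
    |J a - postMean k lam x (fun i => J (x i) + e i) a| ≤
      (B + √(noiseEnergy k x e)) * postStd k lam x a := by
  have hlam0 : 0 < lam := one_pos.trans_le hlam
  set v := (kernelMatrix k x + lam • 1)⁻¹ *ᵥ kernelVec k x a with hv
  have hcov := postCov_self_nonneg hk x hlam0 a
  have hT : ((kernelMatrix k x + lam • 1)⁻¹)ᵀ = (kernelMatrix k x + lam • 1)⁻¹ := by
    have := (posDef_kernelMatrix_add_smul_one hk x hlam0).isHermitian.inv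
    simpa [Matrix.IsHermitian, conjTranspose_eq_transpose_of_trivial] using this
  -- Noise-free regression reproduces `f` tested on `∑ v j Φ (x j)`, so the bias is `f` tested on
  -- the ridge residual of `Φ a`.
  have hbias : J a - kernelVec k x a ⬝ᵥ ((kernelMatrix k x + lam • 1)⁻¹ *ᵥ fun i => J (x i)) =
      inner ℝ f (Φ a - ∑ j, v j • Φ (x j)) := by
    rw [dotProduct_mulVec, ← mulVec_transpose, hT, ← hv, inner_sub_right, inner_sum, hf]
    simp [dotProduct, hf, inner_smul_right]
  have hbias_le : |inner ℝ f (Φ a - ∑ j, v j • Φ (x j))| ≤ B * postStd k lam x a := by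
    refine (abs_real_inner_le_norm _ _).trans ?_
    refine mul_le_mul hB ?_ (norm_nonneg _) ((norm_nonneg _).trans hB)
    rw [postStd]
    refine Real.le_sqrt_of_sq_le ?_
    rw [postCov_self_eq hk x hlam0 a hv]
    have : 0 ≤ v ⬝ᵥ v := by simpa using dotProduct_self_star_nonneg v
    have := mul_nonneg hlam0.le this
    linarith
  have hnoise : |kernelVec k x a ⬝ᵥ ((kernelMatrix k x + lam • 1)⁻¹ *ᵥ e)| ≤
      √(noiseEnergy k x e) * postStd k lam x a := by
    rw [postStd, mul_comm, ← Real.sqrt_mul hcov]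
    exact Real.abs_le_sqrt (sq_kernelVec_dotProduct_inv_mulVec_le hk x hlam a e)
  have hsplit : postMean k lam x (fun i => J (x i) + e i) a =
      kernelVec k x a ⬝ᵥ ((kernelMatrix k x + lam • 1)⁻¹ *ᵥ fun i => J (x i)) +
        kernelVec k x a ⬝ᵥ ((kernelMatrix k x + lam • 1)⁻¹ *ᵥ e) := by
    rw [postMean, ← dotProduct_add, ← mulVec_add]
    rfl
  rw [hsplit, ← sub_sub, hbias, add_mul]
  exact (abs_sub _ _).trans (add_le_add hbias_le hnoise)

/-- The Schur complement of the bordered matrix is the regularization plus the posterior variance of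
the new point. -/
theorem det_kernelMatrix_succ (hk : ∀ x y, k x y = inner ℝ (Φ x) (Φ y)) (z : ℕ → X) (n : ℕ)
    {lam : ℝ} (hlam : 0 < lam) :
    (kernelMatrix k (fun j : Fin (n + 1) => z j) + lam • 1).det =
      (kernelMatrix k (fun j : Fin n => z j) + lam • 1).det *
        (lam + postCov k lam (fun j : Fin n => z j) (z n) (z n)) := by
  set A := kernelMatrix k (fun j : Fin n => z j) + lam • 1 with hA
  have hblock : (kernelMatrix k (fun j : Fin (n + 1) => z j) + lam • 1).submatrix
      finSumFinEquiv finSumFinEquiv =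
      fromBlocks A (replicateCol (Fin 1) (kernelVec k (fun j : Fin n => z j) (z n)))
        (replicateRow (Fin 1) (kernelVec k (fun j : Fin n => z j) (z n)))
        (of fun _ _ => k (z n) (z n) + lam) := by
    ext i j
    rcases i with i | i <;> rcases j with j | j
    · simp [hA, kernelMatrix, one_apply, Fin.ext_iff]
    · simp [kernelMatrix, kernelVec, one_apply, Fin.ext_iff, i.isLt.ne, hk, real_inner_comm]
    · simp [kernelMatrix, kernelVec, one_apply, Fin.ext_iff, j.isLt.ne']
    · simp [kernelMatrix, one_apply, Fin.ext_iff]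
  have : Invertible A := invertibleOfIsUnitDet A (isUnit_det_kernelMatrix_add hk _ hlam)
  rw [← det_submatrix_equiv_self finSumFinEquiv, hblock, det_fromBlocks₁₁,
    det_unique (n := Fin 1), invOf_eq_nonsing_inv, Matrix.sub_apply,
    of_apply, Matrix.mul_assoc, ← replicateCol_mulVec,
    replicateRow_mul_replicateCol_apply, postCov, ← hA]
  ring

/-- Block elimination solves the bordered system explicitly. What the new sample adds beyond `e n ^
2` is the squared prediction error divided by its predictive variance. -/
theorem noiseEnergy_succ (hk : ∀ x y, k x y = inner ℝ (Φ x) (Φ y)) (z : ℕ → X) (e : ℕ → ℝ)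
    (n : ℕ) :
    noiseEnergy k (fun j : Fin (n + 1) => z j) (fun j : Fin (n + 1) => e j) =
      noiseEnergy k (fun j : Fin n => z j) (fun j : Fin n => e j) + e n ^ 2 -
        (e n - postMean k 1 (fun j : Fin n => z j) (fun j : Fin n => e j) (z n)) ^ 2 /
          (1 + postCov k 1 (fun j : Fin n => z j) (z n) (z n)) := by
  set x := fun j : Fin n => z j with hx
  set y := fun j : Fin n => e j with hy
  set κ := kernelVec k x (z n) with hκ
  set u := (kernelMatrix k x + (1 : ℝ) • 1)⁻¹ *ᵥ y with hu
  set v := (kernelMatrix k x + (1 : ℝ) • 1)⁻¹ *ᵥ κ with hv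
  have hue := kernelMatrix_mulVec_inv_add hk x one_pos y
  have hve := kernelMatrix_mulVec_inv_add hk x one_pos κ
  rw [← hu, one_smul] at hue
  rw [← hv, one_smul] at hve
  have hm : postMean k 1 x y (z n) = κ ⬝ᵥ u := rfl
  have hs : postCov k 1 x (z n) (z n) = k (z n) (z n) - κ ⬝ᵥ v := rfl
  have hs0 := postCov_self_nonneg hk x one_pos (z n)
  have hvy : v ⬝ᵥ y = κ ⬝ᵥ u := by
    rw [← hue, ← hve, dotProduct_add, add_dotProduct, dotProduct_comm (kernelMatrix k x *ᵥ v),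
      dotProduct_kernelMatrix_mulVec hk, dotProduct_kernelMatrix_mulVec hk, real_inner_comm]
  set m := κ ⬝ᵥ u with hm'
  set q := k (z n) (z n) - κ ⬝ᵥ v with hq
  rw [hs] at hs0
  -- The last coordinate of the solution: eliminating the first `n` equations leaves `(1 + q) c = e
  -- n - m`.
  set c := (e n - m) / (1 + q) with hc
  have hc' : c * (1 + q) = e n - m := by rw [hc]; field_simp
  have h6 : (e n - m) ^ 2 / (1 + q) = c * (e n - m) := by rw [hc]; ring
  clear_value c q m
  have hsol : kernelMatrix k (fun j : Fin (n + 1) => z j) *ᵥ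
      (Fin.snoc (u - c • v) c : Fin (n + 1) → ℝ) +
      (1 : ℝ) • (Fin.snoc (u - c • v) c : Fin (n + 1) → ℝ) = fun j : Fin (n + 1) => e j := by
    rw [one_smul]
    ext i
    refine Fin.lastCases ?_ (fun i => ?_) i
    · have h1 : ∑ j : Fin n, k (z n) (z j) * (u j - c * v j) = m - c * (κ ⬝ᵥ v) := by
        rw [hm', dotProduct, dotProduct, Finset.mul_sum, ← Finset.sum_sub_distrib]
        refine Finset.sum_congr rfl fun j _ => ?_
        simp only [hκ, kernelVec, hx]
        ring
      obtain ⟨t, ht⟩ : ∃ t, t = κ ⬝ᵥ v := ⟨_, rfl⟩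
      rw [← ht] at h1 hq
      simp only [Pi.add_apply, mulVec, dotProduct, kernelMatrix, of_apply, Fin.sum_univ_castSucc,
        Fin.snoc_castSucc, Fin.snoc_last, Fin.val_castSucc, Fin.val_last, Pi.sub_apply,
        Pi.smul_apply, smul_eq_mul, h1]
      linear_combination hc' - c * hq
    · have h1 := congrFun hue i
      have h2 := congrFun hve i
      simp only [Pi.add_apply, mulVec, dotProduct, kernelMatrix, of_apply] at h1 h2
      have h3 : κ i = k (z i) (z n) := by simp [hκ, kernelVec, hx, hk, real_inner_comm]
      simp only [Pi.add_apply, mulVec, dotProduct, kernelMatrix, of_apply, Fin.sum_univ_castSucc,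
        Fin.snoc_castSucc, Fin.snoc_last, Fin.val_castSucc, Fin.val_last, Pi.sub_apply,
        Pi.smul_apply, smul_eq_mul, mul_sub, Finset.sum_sub_distrib, mul_left_comm _ c,
        ← Finset.mul_sum]
      simp only [hx, hy] at h1 h2
      linear_combination h1 - c * h2 - c * h3
  have hinv := inv_mulVec_eq hk (fun j : Fin (n + 1) => z j) one_pos hsol
  have hdot : ∀ g : Fin (n + 1) → ℝ, (fun j : Fin (n + 1) => e j) ⬝ᵥ g =
      y ⬝ᵥ (fun j : Fin n => g j.castSucc) + e n * g (Fin.last n) := by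
    intro g
    simp [dotProduct, Fin.sum_univ_castSucc, hy]
  rw [noiseEnergy, hinv, hdot, hdot, noiseEnergy, ← hu, hs, hm]
  simp only [Fin.snoc_castSucc, Fin.snoc_last, Fin.val_castSucc, Fin.val_last]
  have h4 : (y ⬝ᵥ fun j : Fin n => (u - c • v) j) = y ⬝ᵥ u - c * m := by
    change y ⬝ᵥ (u - c • v) = _
    rw [dotProduct_sub, dotProduct_smul, smul_eq_mul, dotProduct_comm y v, hvy]
  rw [h4, h6]
  change y ⬝ᵥ y + _ - _ = _
  ring

end FeatureMap

/-! ### Exponential supermartingales -/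

/-- Ville's maximal inequality for nonnegative supermartingales. -/
theorem mul_measure_exists_le_lintegral {Ω : Type*} [m0 : MeasurableSpace Ω] {P : Measure Ω}
    {F : ℕ → MeasurableSpace Ω} (hmono : Monotone F) (hle : ∀ t, F t ≤ m0) {M : ℕ → Ω → ℝ≥0∞}
    (hM : ∀ t, Measurable[F t] (M t))
    (hstep : ∀ t A, MeasurableSet[F t] A → ∫⁻ ω in A, M (t + 1) ω ∂P ≤ ∫⁻ ω in A, M t ω ∂P)
    (c : ℝ≥0∞) : c * P {ω | ∃ t, c ≤ M t ω} ≤ ∫⁻ ω, M 0 ω ∂P := by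
  -- The invariant keeps the mass of paths that have not yet reached `c`; dropping it would leave
  -- nothing to charge the next crossing to.
  have hbound : ∀ n, MeasurableSet[F n] {ω | ∀ s ≤ n, M s ω < c} ∧
      c * P {ω | ∃ s ≤ n, c ≤ M s ω} + ∫⁻ ω in {ω | ∀ s ≤ n, M s ω < c}, M n ω ∂P ≤
        ∫⁻ ω, M 0 ω ∂P := by
    intro n
    induction n with
    | zero =>
      have hA : MeasurableSet[F 0] {ω | M 0 ω < c} := hM 0 measurableSet_Iio
      have hB : MeasurableSet {ω | c ≤ M 0 ω} := hle 0 _ (hM 0 measurableSet_Ici)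
      have hcompl : {ω | M 0 ω < c} = {ω | c ≤ M 0 ω}ᶜ := by ext; simp
      simp only [Nat.le_zero, forall_eq, exists_eq_left]
      refine ⟨hA, ?_⟩
      rw [hcompl, ← lintegral_add_compl (μ := P) (M 0) hB]
      refine add_le_add ?_ le_rfl
      rw [← setLIntegral_const]
      exact setLIntegral_mono_ae' hB (.of_forall fun ω h => h)
    | succ n ih =>
      obtain ⟨hAn, ih⟩ := ih
      set A := {ω | ∀ s ≤ n, M s ω < c} with hA
      set C := {ω | c ≤ M (n + 1) ω} with hC
      have hCm : MeasurableSet[F (n + 1)] C := hM (n + 1) measurableSet_Ici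
      have hAm : MeasurableSet[F (n + 1)] A := hmono n.le_succ _ hAn
      have hAsucc : {ω | ∀ s ≤ n + 1, M s ω < c} = A \ C := by
        ext ω
        simp only [hA, hC, Set.mem_ofPred_eq, Set.mem_sdiff, not_le]
        refine ⟨fun h => ⟨fun s hs => h s (hs.trans n.le_succ), h _ le_rfl⟩, fun h s hs => ?_⟩
        rcases Nat.le_succ_iff.1 hs with hs | rfl
        exacts [h.1 s hs, h.2]
      have hBsucc : {ω | ∃ s ≤ n + 1, c ≤ M s ω} ⊆ {ω | ∃ s ≤ n, c ≤ M s ω} ∪ A ∩ C := by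
        rintro ω ⟨s, hs, h⟩
        by_cases hω : ∃ s ≤ n, c ≤ M s ω
        · exact Or.inl hω
        · refine Or.inr ⟨by simpa [hA] using hω, ?_⟩
          rcases Nat.le_succ_iff.1 hs with hs | rfl
          exacts [(hω ⟨s, hs, h⟩).elim, h]
      rw [hAsucc]
      refine ⟨hAm.diff hCm, ?_⟩
      calc c * P {ω | ∃ s ≤ n + 1, c ≤ M s ω} + ∫⁻ ω in A \ C, M (n + 1) ω ∂P
          ≤ c * (P {ω | ∃ s ≤ n, c ≤ M s ω} + P (A ∩ C)) + ∫⁻ ω in A \ C, M (n + 1) ω ∂P := by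
            gcongr
            exact (measure_mono hBsucc).trans (measure_union_le _ _)
        _ = c * P {ω | ∃ s ≤ n, c ≤ M s ω} +
              (c * P (A ∩ C) + ∫⁻ ω in A \ C, M (n + 1) ω ∂P) := by rw [mul_add, add_assoc]
        _ ≤ c * P {ω | ∃ s ≤ n, c ≤ M s ω} +
              (∫⁻ ω in A ∩ C, M (n + 1) ω ∂P + ∫⁻ ω in A \ C, M (n + 1) ω ∂P) := by
            gcongr
            rw [← setLIntegral_const]
            exact setLIntegral_mono_ae' (hle _ _ (hAm.inter hCm)) (.of_forall fun ω h => h.2)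
        _ = c * P {ω | ∃ s ≤ n, c ≤ M s ω} + ∫⁻ ω in A, M (n + 1) ω ∂P := by
            rw [lintegral_inter_add_sdiff _ _ (hle _ _ hCm)]
        _ ≤ _ := (add_le_add le_rfl (hstep n A hAn)).trans ih
  have hUnion : {ω | ∃ t, c ≤ M t ω} = ⋃ n, {ω | ∃ s ≤ n, c ≤ M s ω} := by
    ext ω
    simp only [Set.mem_ofPred_eq, Set.mem_iUnion]
    exact ⟨fun ⟨t, h⟩ => ⟨t, t, le_rfl, h⟩, fun ⟨_, t, _, h⟩ => ⟨t, h⟩⟩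
  have hmonoB : Monotone fun n => {ω | ∃ s ≤ n, c ≤ M s ω} :=
    fun i j hij ω ⟨s, hs, h⟩ => ⟨s, hs.trans hij, h⟩
  rw [hUnion, hmonoB.measure_iUnion, ENNReal.mul_iSup]
  exact iSup_le fun n => le_self_add.trans (hbound n).2

section SubGaussian

variable {Ω : Type*} {m m0 : MeasurableSpace Ω} {P : Measure Ω} [IsFiniteMeasure P]
  {ξ : Ω → ℝ} {R : ℝ}

/-- The exponential factor, used as a density, gives every event of `m` at most its `P`-mass. This
is an inequality between measures trimmed to `m`, so it passes to any nonnegative `m`-measurable `G`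
without integrability of `G`. -/
theorem lintegral_mul_exp_const_le (hm : m ≤ m0) (hξ : Measurable[m0] ξ) (c : ℝ)
    (hint : Integrable (fun ω => Real.exp (c * ξ ω)) P)
    (hcond : P[fun ω => Real.exp (c * ξ ω) | m] ≤ᵐ[P] fun _ => Real.exp (c ^ 2 * R ^ 2 / 2))
    {G : Ω → ℝ≥0∞} (hG : Measurable[m] G) :
    ∫⁻ ω, G ω * ENNReal.ofReal (Real.exp (c * ξ ω - c ^ 2 * R ^ 2 / 2)) ∂P ≤ ∫⁻ ω, G ω ∂P := by
  set E := fun ω => ENNReal.ofReal (Real.exp (c * ξ ω - c ^ 2 * R ^ 2 / 2)) with hE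
  have hEm : Measurable[m0] E := by fun_prop
  have hmeas : (P.withDensity E).trim hm ≤ P.trim hm := by
    refine Measure.le_iff.2 fun A hA => ?_
    rw [trim_measurableSet_eq hm hA, trim_measurableSet_eq hm hA, withDensity_apply _ (hm _ hA)]
    have h1 : ∫ ω in A, Real.exp (c * ξ ω - c ^ 2 * R ^ 2 / 2) ∂P ≤ P.real A := by
      have h2 : ∀ ω, Real.exp (c * ξ ω - c ^ 2 * R ^ 2 / 2) =
          Real.exp (c * ξ ω) * (Real.exp (c ^ 2 * R ^ 2 / 2))⁻¹ := fun ω => by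
        rw [Real.exp_sub, div_eq_mul_inv]
      simp only [h2]
      rw [integral_mul_const, ← setIntegral_condExp hm hint hA, ← div_eq_mul_inv,
        div_le_iff₀ (Real.exp_pos _)]
      calc ∫ ω in A, (P[fun ω => Real.exp (c * ξ ω) | m]) ω ∂P
          ≤ ∫ _ in A, Real.exp (c ^ 2 * R ^ 2 / 2) ∂P :=
            integral_mono_ae integrable_condExp.integrableOn (integrable_const _)
              (ae_restrict_of_ae hcond)
        _ = _ := by simp
    have hint' : Integrable (fun ω => Real.exp (c * ξ ω - c ^ 2 * R ^ 2 / 2)) P := by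
      simp only [Real.exp_sub]
      exact hint.div_const _
    rw [hE, ← ofReal_integral_eq_lintegral_ofReal hint'.integrableOn
      (.of_forall fun _ => (Real.exp_pos _).le)]
    exact (ENNReal.ofReal_le_ofReal h1).trans (ENNReal.ofReal_toReal_le)
  calc ∫⁻ ω, G ω * E ω ∂P = ∫⁻ ω, G ω ∂(P.withDensity E) := by
        rw [lintegral_withDensity_eq_lintegral_mul _ hEm (hG.mono hm le_rfl)]
        exact lintegral_congr fun ω => mul_comm _ _
    _ = ∫⁻ ω, G ω ∂((P.withDensity E).trim hm) := (lintegral_trim hm hG).symm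
    _ ≤ ∫⁻ ω, G ω ∂(P.trim hm) := lintegral_mono' hmeas le_rfl
    _ = ∫⁻ ω, G ω ∂P := lintegral_trim hm hG

theorem exists_finset_valued_approx {Ω : Type*} [MeasurableSpace Ω] {g : Ω → ℝ}
    (hg : Measurable g) : ∃ (f : ℕ → Ω → ℝ) (S : ℕ → Finset ℝ), (∀ n, Measurable (f n)) ∧
      (∀ n ω, f n ω ∈ S n) ∧
      ∀ ω, Filter.Tendsto (fun n => f n ω) Filter.atTop (nhds (g ω)) :=
  ⟨fun n => hg.stronglyMeasurable.approx n, fun n => (hg.stronglyMeasurable.approx n).range,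
    fun n => (hg.stronglyMeasurable.approx n).measurable,
    fun n ω => (hg.stronglyMeasurable.approx n).mem_range_self ω,
    fun ω => hg.stronglyMeasurable.tendsto_approx ω⟩

/-- Conditional sub-Gaussianity also bounds the exponential moment with a random exponent
that is known in advance. -/
theorem lintegral_mul_exp_le (hm : m ≤ m0) (hξ : Measurable[m0] ξ)
    (hsub : ∀ c : ℝ, Integrable (fun ω => Real.exp (c * ξ ω)) P ∧
      P[fun ω => Real.exp (c * ξ ω) | m] ≤ᵐ[P] fun _ => Real.exp (c ^ 2 * R ^ 2 / 2))
    {G : Ω → ℝ≥0∞} (hG : Measurable[m] G) {g : Ω → ℝ} (hg : Measurable[m] g) :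
    ∫⁻ ω, G ω * ENNReal.ofReal (Real.exp (g ω * ξ ω - g ω ^ 2 * R ^ 2 / 2)) ∂P ≤
      ∫⁻ ω, G ω ∂P := by
  -- A finitely valued exponent is constant on events of `m`, so the constant case applies with `G`
  -- restricted to each level set.
  have hsimple : ∀ (f : Ω → ℝ) (S : Finset ℝ), Measurable[m] f → (∀ ω, f ω ∈ S) →
      ∫⁻ ω, G ω * ENNReal.ofReal (Real.exp (f ω * ξ ω - f ω ^ 2 * R ^ 2 / 2)) ∂P ≤
        ∫⁻ ω, G ω ∂P := by
    intro f S hf hS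
    have hfm : ∀ c, MeasurableSet[m] (f ⁻¹' {c}) := fun c => hf (measurableSet_singleton c)
    have hsplit : ∀ (T : ℝ → Ω → ℝ≥0∞) (ω : Ω),
        T (f ω) ω = ∑ c ∈ S, (f ⁻¹' {c}).indicator (T c) ω := by
      intro T ω
      rw [Finset.sum_eq_single_of_mem (f ω) (hS ω)]
      · simp
      · intro c _ hc
        exact Set.indicator_of_notMem (fun h => hc (by simpa using h.symm)) _
    calc ∫⁻ ω, G ω * ENNReal.ofReal (Real.exp (f ω * ξ ω - f ω ^ 2 * R ^ 2 / 2)) ∂P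
        = ∫⁻ ω, ∑ c ∈ S, (f ⁻¹' {c}).indicator G ω *
            ENNReal.ofReal (Real.exp (c * ξ ω - c ^ 2 * R ^ 2 / 2)) ∂P := by
          refine lintegral_congr fun ω => ?_
          rw [hsplit (fun c ω => G ω * ENNReal.ofReal (Real.exp (c * ξ ω - c ^ 2 * R ^ 2 / 2)))]
          exact Finset.sum_congr rfl fun c _ => Set.indicator_mul_left _ _ _
      _ = ∑ c ∈ S, ∫⁻ ω, (f ⁻¹' {c}).indicator G ω *
            ENNReal.ofReal (Real.exp (c * ξ ω - c ^ 2 * R ^ 2 / 2)) ∂P := by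
          refine lintegral_finsetSum _ fun c _ => ?_
          have : Measurable[m0] ((f ⁻¹' {c}).indicator G) :=
            (hG.indicator (hfm c)).mono hm le_rfl
          fun_prop
      _ ≤ ∑ c ∈ S, ∫⁻ ω, (f ⁻¹' {c}).indicator G ω ∂P :=
          Finset.sum_le_sum fun c _ => lintegral_mul_exp_const_le hm hξ c (hsub c).1 (hsub c).2
            (hG.indicator (hfm c))
      _ = ∫⁻ ω, ∑ c ∈ S, (f ⁻¹' {c}).indicator G ω ∂P :=
          (lintegral_finsetSum _ fun c _ => (hG.indicator (hfm c)).mono hm le_rfl).symm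
      _ = ∫⁻ ω, G ω ∂P := lintegral_congr fun ω => (hsplit (fun _ => G) ω).symm
  obtain ⟨f, S, hf, hS, hlimf⟩ := @exists_finset_valued_approx Ω m g hg
  have hlim : ∀ ω, Filter.liminf (fun n => G ω * ENNReal.ofReal
      (Real.exp (f n ω * ξ ω - f n ω ^ 2 * R ^ 2 / 2))) Filter.atTop =
      G ω * ENNReal.ofReal (Real.exp (g ω * ξ ω - g ω ^ 2 * R ^ 2 / 2)) := by
    intro ω
    refine Filter.Tendsto.liminf_eq ?_
    refine ENNReal.Tendsto.const_mul ?_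
      (Or.inl (by simpa using Real.exp_pos (g ω * ξ ω - g ω ^ 2 * R ^ 2 / 2)))
    have hcont : Continuous fun c : ℝ =>
        ENNReal.ofReal (Real.exp (c * ξ ω - c ^ 2 * R ^ 2 / 2)) :=
      ENNReal.continuous_ofReal.comp (by fun_prop)
    exact (hcont.tendsto (g ω)).comp (hlimf ω)
  -- Fatou's lemma suffices for the passage to the limit, since only an upper bound is wanted.
  calc ∫⁻ ω, G ω * ENNReal.ofReal (Real.exp (g ω * ξ ω - g ω ^ 2 * R ^ 2 / 2)) ∂P
      = ∫⁻ ω, Filter.liminf (fun n => G ω * ENNReal.ofReal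
          (Real.exp (f n ω * ξ ω - f n ω ^ 2 * R ^ 2 / 2))) Filter.atTop ∂P :=
        lintegral_congr fun ω => (hlim ω).symm
    _ ≤ Filter.liminf (fun n => ∫⁻ ω, G ω * ENNReal.ofReal
          (Real.exp (f n ω * ξ ω - f n ω ^ 2 * R ^ 2 / 2)) ∂P) Filter.atTop := by
        refine lintegral_liminf_le fun n => ?_
        have h1 : Measurable[m0] (f n) := (hf n).mono hm le_rfl
        have h2 : Measurable[m0] G := hG.mono hm le_rfl
        fun_prop
    _ ≤ ∫⁻ ω, G ω ∂P :=
        (Filter.liminf_le_liminf (.of_forall fun n => hsimple (f n) (S n) (hf n) (hS n))).trans_eq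
          (Filter.liminf_const _)

end SubGaussian

/-- Averaging the exponential martingale increments over a Gaussian prior `N(m, s²)`. -/
theorem lintegral_gaussian_exp_mul_sub_sq (m s x : ℝ) :
    ∫⁻ h, ENNReal.ofReal (Real.exp ((m + s * h) * x - (m + s * h) ^ 2 / 2)) ∂gaussianReal 0 1 =
      ENNReal.ofReal ((√(1 + s ^ 2))⁻¹ * Real.exp ((x ^ 2 - (x - m) ^ 2 / (1 + s ^ 2)) / 2)) := by
  have hs : 0 < 1 + s ^ 2 := by positivity
  set v : ℝ≥0 := ⟨(1 + s ^ 2)⁻¹, by positivity⟩ with hv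
  have hv0 : v ≠ 0 := by
    rw [Ne, ← NNReal.coe_eq_zero]
    exact (inv_pos.2 hs).ne'
  -- Completing the square in `h` leaves a Gaussian density of mean `μ` and variance `(1 + s ^
  -- 2)⁻¹`, times the constant `C`.
  set μ := s * (x - m) / (1 + s ^ 2) with hμ
  set C := (√(1 + s ^ 2))⁻¹ * Real.exp ((x ^ 2 - (x - m) ^ 2 / (1 + s ^ 2)) / 2) with hC
  have hC0 : 0 ≤ C := by positivity
  rw [gaussianReal_of_var_ne_zero 0 one_ne_zero,
    lintegral_withDensity_eq_lintegral_mul _ (by fun_prop) (by fun_prop)]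
  calc _ = ∫⁻ h, ENNReal.ofReal C * gaussianPDF μ v h := by
        refine lintegral_congr fun h => ?_
        rw [Pi.mul_apply, gaussianPDF, gaussianPDF, ← ENNReal.ofReal_mul hC0,
          ← ENNReal.ofReal_mul (gaussianPDFReal_nonneg _ _ _)]
        congr 1
        rw [gaussianPDFReal, gaussianPDFReal, hC]
        have h1 : √(2 * Real.pi * (v : ℝ)) = √(2 * Real.pi) * (√(1 + s ^ 2))⁻¹ := by
          rw [Real.sqrt_mul (by positivity), ← Real.sqrt_inv]
          rfl
        have h2 : ((v : ℝ≥0) : ℝ) = (1 + s ^ 2)⁻¹ := rfl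
        have h3 : √(1 + s ^ 2) ≠ 0 := (Real.sqrt_pos.2 hs).ne'
        rw [h1, h2, mul_assoc, ← Real.exp_add]
        have h4 : (√(1 + s ^ 2))⁻¹ * Real.exp ((x ^ 2 - (x - m) ^ 2 / (1 + s ^ 2)) / 2) *
            ((√(2 * Real.pi) * (√(1 + s ^ 2))⁻¹)⁻¹ *
              Real.exp (-(h - μ) ^ 2 / (2 * (1 + s ^ 2)⁻¹))) =
            (√(2 * Real.pi))⁻¹ * Real.exp ((x ^ 2 - (x - m) ^ 2 / (1 + s ^ 2)) / 2 +
              -(h - μ) ^ 2 / (2 * (1 + s ^ 2)⁻¹)) := by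
          rw [Real.exp_add]
          field_simp
        rw [h4]
        congr 2
        · simp
        · rw [hμ]
          push_cast
          field_simp
          ring
    _ = ENNReal.ofReal C := by
        rw [lintegral_const_mul _ (by fun_prop), lintegral_gaussianPDF_eq_one _ hv0, mul_one]

/-! ### Measurability of the regression quantities -/

section Measurability

variable {X Ω : Type*} [MeasurableSpace X] [MeasurableSpace Ω] {k : X → X → ℝ}

theorem measurable_dotProduct {n : Type*} [Fintype n] {u v : Ω → n → ℝ}
    (hu : ∀ i, Measurable fun ω => u ω i) (hv : ∀ i, Measurable fun ω => v ω i) :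
    Measurable fun ω => u ω ⬝ᵥ v ω :=
  Finset.measurable_fun_sum _ fun i _ => (hu i).mul (hv i)

theorem measurable_mulVec_apply {n : Type*} [Fintype n] {A : Ω → Matrix n n ℝ} {v : Ω → n → ℝ}
    (hA : ∀ i j, Measurable fun ω => A ω i j) (hv : ∀ i, Measurable fun ω => v ω i) (i : n) :
    Measurable fun ω => (A ω *ᵥ v ω) i :=
  measurable_dotProduct (hA i) hv

theorem measurable_det {n : Type*} [Fintype n] [DecidableEq n] {A : Ω → Matrix n n ℝ}
    (hA : ∀ i j, Measurable fun ω => A ω i j) : Measurable fun ω => (A ω).det := by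
  simp only [det_apply]
  fun_prop

theorem measurable_inv_apply {n : Type*} [Fintype n] [DecidableEq n] {A : Ω → Matrix n n ℝ}
    (hA : ∀ i j, Measurable fun ω => A ω i j) (i j : n) : Measurable fun ω => (A ω)⁻¹ i j := by
  simp only [inv_def, Ring.inverse_eq_inv', Matrix.smul_apply, smul_eq_mul, adjugate_apply]
  refine (measurable_det hA).inv.mul (measurable_det fun a b => ?_)
  by_cases h : a = j
  · subst h
    simp
  · simpa [updateRow_ne h] using hA a b

variable {n : ℕ} {x : Ω → Fin n → X} {e : Ω → Fin n → ℝ} {a b : Ω → X}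

theorem measurable_kernelMatrix_apply (hk : Measurable fun q : X × X => k q.1 q.2)
    (hx : ∀ i, Measurable fun ω => x ω i) (lam : ℝ) (i j : Fin n) :
    Measurable fun ω => (kernelMatrix k (x ω) + lam • 1) i j := by
  simp only [kernelMatrix, Matrix.add_apply, of_apply]
  exact (hk.comp ((hx i).prodMk (hx j))).add_const _

theorem measurable_postMean (hk : Measurable fun q : X × X => k q.1 q.2)
    (hx : ∀ i, Measurable fun ω => x ω i) (he : ∀ i, Measurable fun ω => e ω i)
    (ha : Measurable a) (lam : ℝ) :
    Measurable fun ω => postMean k lam (x ω) (e ω) (a ω) := by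
  have h1 := measurable_inv_apply (measurable_kernelMatrix_apply hk hx lam)
  have h2 : ∀ i, Measurable fun ω => k (a ω) (x ω i) := fun i => hk.comp (ha.prodMk (hx i))
  exact measurable_dotProduct h2 (measurable_mulVec_apply h1 he)

theorem measurable_postCov (hk : Measurable fun q : X × X => k q.1 q.2)
    (hx : ∀ i, Measurable fun ω => x ω i) (ha : Measurable a) (hb : Measurable b) (lam : ℝ) :
    Measurable fun ω => postCov k lam (x ω) (a ω) (b ω) := by
  have h1 := measurable_postMean (e := fun ω => kernelVec k (x ω) (b ω)) hk hx
    (fun i => hk.comp (hb.prodMk (hx i))) ha lam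
  exact (hk.comp (ha.prodMk hb)).sub h1

theorem measurable_noiseEnergy (hk : Measurable fun q : X × X => k q.1 q.2)
    (hx : ∀ i, Measurable fun ω => x ω i) (he : ∀ i, Measurable fun ω => e ω i) :
    Measurable fun ω => noiseEnergy k (x ω) (e ω) := by
  have h1 := measurable_inv_apply (measurable_kernelMatrix_apply hk hx 1)
  exact (measurable_dotProduct he he).sub
    (measurable_dotProduct he (measurable_mulVec_apply h1 he))

end Measurability

/-! ### Time-uniform control of the noise -/

/-- The self-normalized process `det(I + K_t)^{-1/2} exp(eᵀ K_t (K_t + I)⁻¹ e / (2 R²))`. -/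
noncomputable def selfNormalized {X : Type*} (k : X → X → ℝ) (R : ℝ) (z : ℕ → X) (e : ℕ → ℝ)
    (t : ℕ) : ℝ≥0∞ :=
  ENNReal.ofReal ((√(kernelMatrix k (fun j : Fin t => z j) + (1 : ℝ) • 1).det)⁻¹ *
    Real.exp (noiseEnergy k (fun j : Fin t => z j) (fun j : Fin t => e j) / (2 * R ^ 2)))

theorem measurable_selfNormalized {X Ω : Type*} [MeasurableSpace X] [MeasurableSpace Ω]
    {k : X → X → ℝ} (hk : Measurable fun q : X × X => k q.1 q.2) (R : ℝ) {z : ℕ → Ω → X}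
    {e : ℕ → Ω → ℝ} {t : ℕ} (hz : ∀ j < t, Measurable (z j)) (he : ∀ j < t, Measurable (e j)) :
    Measurable fun ω => selfNormalized k R (fun j => z j ω) (fun j => e j ω) t := by
  have h1 := measurable_det (measurable_kernelMatrix_apply
    (x := fun ω (j : Fin t) => z j ω) hk (fun i => hz i i.isLt) 1)
  have h2 := measurable_noiseEnergy (x := fun ω (j : Fin t) => z j ω)
    (e := fun ω (j : Fin t) => e j ω) hk (fun i => hz i i.isLt) (fun i => he i i.isLt)
  exact ((h1.sqrt.inv).mul ((h2.div_const _).exp)).ennreal_ofReal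

section Confidence

variable {X H : Type*} [NormedAddCommGroup H] [InnerProductSpace ℝ H]
  {k : X → X → ℝ} {Φ : X → H}

theorem selfNormalized_zero (k : X → X → ℝ) (R : ℝ) (z : ℕ → X) (e : ℕ → ℝ) :
    selfNormalized k R z e 0 = 1 := by
  simp [selfNormalized, noiseEnergy]

/-- A Gaussian-process mixture is updated through its posterior: the scaled noise `e / R` gives
posterior mean `m / R` and deviation `s` at `z t`, and the next factor averages the exponential
increment over that Gaussian. The determinant recursion supplies `1 / √(1 + s ^ 2)`, the recursion
for `noiseEnergy` the exponent. -/
theorem selfNormalized_succ (hk : ∀ x y, k x y = inner ℝ (Φ x) (Φ y)) {R : ℝ} (hR : 0 < R)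
    (z : ℕ → X) (e : ℕ → ℝ) (t : ℕ) :
    selfNormalized k R z e (t + 1) = selfNormalized k R z e t *
      ∫⁻ h, ENNReal.ofReal (Real.exp
        ((postMean k 1 (fun j : Fin t => z j) (fun j : Fin t => e j) (z t) / R +
          postStd k 1 (fun j : Fin t => z j) (z t) * h) / R * e t -
        ((postMean k 1 (fun j : Fin t => z j) (fun j : Fin t => e j) (z t) / R +
          postStd k 1 (fun j : Fin t => z j) (z t) * h) / R) ^ 2 * R ^ 2 / 2))
        ∂gaussianReal 0 1 := by
  have hcov := postCov_self_nonneg hk (fun j : Fin t => z j) one_pos (z t)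
  have hdet := (posDef_kernelMatrix_add_smul_one hk (fun j : Fin t => z j) one_pos).det_pos
  have hstd : postStd k 1 (fun j : Fin t => z j) (z t) ^ 2 =
      postCov k 1 (fun j : Fin t => z j) (z t) (z t) := Real.sq_sqrt hcov
  rw [selfNormalized, selfNormalized, det_kernelMatrix_succ hk z t one_pos,
    noiseEnergy_succ hk, ← hstd]
  set m := postMean k 1 (fun j : Fin t => z j) (fun j : Fin t => e j) (z t)
  set s := postStd k 1 (fun j : Fin t => z j) (z t)
  set N := noiseEnergy k (fun j : Fin t => z j) (fun j : Fin t => e j)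
  set D := (kernelMatrix k (fun j : Fin t => z j) + (1 : ℝ) • 1).det
  have hscale : ∀ h, (m / R + s * h) / R * e t - ((m / R + s * h) / R) ^ 2 * R ^ 2 / 2 =
      (m / R + s * h) * (e t / R) - (m / R + s * h) ^ 2 / 2 := fun h => by
    field_simp
  simp only [hscale]
  have hs : 0 < 1 + s ^ 2 := by positivity
  rw [lintegral_gaussian_exp_mul_sub_sq, ← ENNReal.ofReal_mul (by positivity),
    Real.sqrt_mul hdet.le, mul_inv]
  congr 1
  have hexp : (N + e t ^ 2 - (e t - m) ^ 2 / (1 + s ^ 2)) / (2 * R ^ 2) =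
      N / (2 * R ^ 2) + ((e t / R) ^ 2 - (e t / R - m / R) ^ 2 / (1 + s ^ 2)) / 2 := by
    field_simp
    ring
  rw [hexp, Real.exp_add]
  ring

theorem history_mono {X Ω : Type*} [MeasurableSpace X] (z : ℕ → Ω → X) (ξ : ℕ → Ω → ℝ) :
    Monotone (history z ξ) := fun _ _ hst =>
  sup_le_sup (biSup_mono fun _ h => h.trans hst) (biSup_mono fun _ h => h.trans_le hst)

theorem history_le {X Ω : Type*} [MeasurableSpace X] [m0 : MeasurableSpace Ω] {z : ℕ → Ω → X}
    {ξ : ℕ → Ω → ℝ} (hz : ∀ i, Measurable (z i)) (hξ : ∀ i, Measurable (ξ i)) (t : ℕ) :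
    history z ξ t ≤ m0 :=
  sup_le (iSup₂_le fun j _ => (hz j).comap_le) (iSup₂_le fun j _ => (hξ j).comap_le)

theorem measurable_history_point {X Ω : Type*} [MeasurableSpace X] (z : ℕ → Ω → X)
    (ξ : ℕ → Ω → ℝ) {j t : ℕ} (h : j ≤ t) : Measurable[history z ξ t] (z j) :=
  measurable_iff_comap_le.2 (le_sup_of_le_left
    (le_iSup₂_of_le (f := fun (j : ℕ) (_ : j ≤ t) => MeasurableSpace.comap (z j) inferInstance)
      j h le_rfl))

theorem measurable_history_noise {X Ω : Type*} [MeasurableSpace X] (z : ℕ → Ω → X)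
    (ξ : ℕ → Ω → ℝ) {j t : ℕ} (h : j < t) : Measurable[history z ξ t] (ξ j) :=
  measurable_iff_comap_le.2 (le_sup_of_le_right
    (le_iSup₂_of_le (f := fun (j : ℕ) (_ : j < t) => MeasurableSpace.comap (ξ j) inferInstance)
      j h le_rfl))

/-- The supermartingale property, tested on events of the history: after Tonelli, the exponent for
each fixed Gaussian value `h` is known before `ξ t` is drawn. -/
theorem setLIntegral_selfNormalized_succ_le [MeasurableSpace X] {Ω : Type*}
    [m0 : MeasurableSpace Ω] {P : Measure Ω} [IsFiniteMeasure P]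
    (hk : ∀ x y, k x y = inner ℝ (Φ x) (Φ y)) (hkm : Measurable fun q : X × X => k q.1 q.2)
    {R : ℝ} (hR : 0 < R) {z : ℕ → Ω → X} {ξ : ℕ → Ω → ℝ} (hz : ∀ i, Measurable (z i))
    (hξ : ∀ i, Measurable (ξ i)) (hsub : SubGaussianNoise P z ξ R) (t : ℕ) {A : Set Ω}
    (hA : MeasurableSet[history z ξ t] A) :
    ∫⁻ ω in A, selfNormalized k R (fun j => z j ω) (fun j => ξ j ω) (t + 1) ∂P ≤
      ∫⁻ ω in A, selfNormalized k R (fun j => z j ω) (fun j => ξ j ω) t ∂P := by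
  have hle := history_le hz hξ t
  set M := fun ω => selfNormalized k R (fun j => z j ω) (fun j => ξ j ω) t with hM
  set m := fun ω => postMean k 1 (fun j : Fin t => z j ω) (fun j : Fin t => ξ j ω) (z t ω) with hm
  set s := fun ω => postStd k 1 (fun j : Fin t => z j ω) (z t ω) with hs
  set g := fun (h : ℝ) ω => (m ω / R + s ω * h) / R with hg
  have hzt : ∀ i : Fin t, Measurable[history z ξ t] (z i) :=
    fun i => measurable_history_point z ξ i.isLt.le
  have hξt : ∀ i : Fin t, Measurable[history z ξ t] (ξ i) :=
    fun i => measurable_history_noise z ξ i.isLt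
  -- The history at `t` includes the point `z t` but not its noise; the posterior at `z t` may
  -- therefore enter the exponent.
  have hztt : Measurable[history z ξ t] (z t) := measurable_history_point z ξ le_rfl
  have hMm : Measurable[history z ξ t] M :=
    @measurable_selfNormalized X Ω _ (history z ξ t) k hkm R z ξ t
      (fun j hj => hzt ⟨j, hj⟩) (fun j hj => hξt ⟨j, hj⟩)
  have hmm : Measurable[history z ξ t] m :=
    @measurable_postMean X Ω _ (history z ξ t) k t (fun ω (j : Fin t) => z j ω)
      (fun ω (j : Fin t) => ξ j ω) (z t) hkm hzt hξt hztt 1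
  have hsm : Measurable[history z ξ t] s :=
    (@measurable_postCov X Ω _ (history z ξ t) k t (fun ω (j : Fin t) => z j ω)
      (z t) (z t) hkm hzt hztt hztt 1).sqrt
  have hgm : ∀ h, Measurable[history z ξ t] (g h) := fun h =>
    ((hmm.div_const R).add (hsm.mul_const h)).div_const R
  have hGm : Measurable[history z ξ t] (A.indicator M) := hMm.indicator hA
  calc ∫⁻ ω in A, selfNormalized k R (fun j => z j ω) (fun j => ξ j ω) (t + 1) ∂P
      = ∫⁻ ω, ∫⁻ h, A.indicator M ω * ENNReal.ofReal
          (Real.exp (g h ω * ξ t ω - g h ω ^ 2 * R ^ 2 / 2)) ∂gaussianReal 0 1 ∂P := by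
        rw [← lintegral_indicator (hle _ hA)]
        refine lintegral_congr fun ω => ?_
        rw [lintegral_const_mul _ (by fun_prop)]
        by_cases hω : ω ∈ A
        · simp only [Set.indicator_of_mem hω]
          exact selfNormalized_succ hk hR _ _ t
        · simp [Set.indicator_of_notMem hω]
    _ = ∫⁻ h, ∫⁻ ω, A.indicator M ω * ENNReal.ofReal
          (Real.exp (g h ω * ξ t ω - g h ω ^ 2 * R ^ 2 / 2)) ∂P ∂gaussianReal 0 1 := by
        refine lintegral_lintegral_swap (Measurable.aemeasurable ?_)
        have h1 : Measurable[m0] (A.indicator M) := hGm.mono hle le_rfl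
        have h2 : Measurable[m0] m := hmm.mono hle le_rfl
        have h3 : Measurable[m0] s := hsm.mono hle le_rfl
        have h4 := hξ t
        simp only [hg]
        fun_prop
    _ ≤ ∫⁻ _, ∫⁻ ω, A.indicator M ω ∂P ∂gaussianReal 0 1 :=
        lintegral_mono fun h => lintegral_mul_exp_le hle (hξ t) (hsub t) hGm (hgm h)
    _ = ∫⁻ ω in A, M ω ∂P := by
        rw [lintegral_const, measure_univ, mul_one, lintegral_indicator (hle _ hA)]

/-- Time-uniform self-normalized tail bound. -/
theorem measure_exists_le_selfNormalized [MeasurableSpace X] {Ω : Type*}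
    [MeasurableSpace Ω] {P : Measure Ω} [IsProbabilityMeasure P]
    (hk : ∀ x y, k x y = inner ℝ (Φ x) (Φ y)) (hkm : Measurable fun q : X × X => k q.1 q.2)
    {R δ : ℝ} (hR : 0 < R) (hδ : 0 < δ) {z : ℕ → Ω → X} {ξ : ℕ → Ω → ℝ}
    (hz : ∀ i, Measurable (z i)) (hξ : ∀ i, Measurable (ξ i))
    (hsub : SubGaussianNoise P z ξ R) :
    P {ω | ∃ t, ENNReal.ofReal δ⁻¹ ≤ selfNormalized k R (fun j => z j ω) (fun j => ξ j ω) t} ≤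
      ENNReal.ofReal δ := by
  have h := mul_measure_exists_le_lintegral (P := P) (history_mono z ξ) (history_le hz hξ)
    (M := fun t ω => selfNormalized k R (fun j => z j ω) (fun j => ξ j ω) t)
    (fun t => @measurable_selfNormalized X Ω _ (history z ξ t) k hkm R z ξ t
      (fun j hj => measurable_history_point z ξ hj.le)
      (fun j hj => measurable_history_noise z ξ hj))
    (fun t A hA => setLIntegral_selfNormalized_succ_le hk hkm hR hz hξ hsub t hA)
    (ENNReal.ofReal δ⁻¹)
  simp only [selfNormalized_zero, lintegral_const, measure_univ, mul_one] at h
  rw [ENNReal.ofReal_inv_of_pos hδ] at h ⊢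
  rw [mul_comm] at h
  simpa using ENNReal.le_inv_iff_mul_le.2 h

theorem sqrt_noiseEnergy_le_of_selfNormalized_lt (hk : ∀ x y, k x y = inner ℝ (Φ x) (Φ y))
    {R δ : ℝ} (hR : 0 < R) (hδ : 0 < δ) {z : ℕ → X} {e : ℕ → ℝ} {t : ℕ}
    (h : selfNormalized k R z e t < ENNReal.ofReal δ⁻¹) :
    √(noiseEnergy k (fun j : Fin t => z j) (fun j : Fin t => e j)) ≤
      R * √(2 * Real.log
        (√(kernelMatrix k (fun j : Fin t => z j) + (1 : ℝ) • 1).det / δ)) := by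
  have hdet := (posDef_kernelMatrix_add_smul_one hk (fun j : Fin t => z j) one_pos).det_pos
  rw [selfNormalized, ENNReal.ofReal_lt_ofReal_iff (by positivity)] at h
  set D := (kernelMatrix k (fun j : Fin t => z j) + (1 : ℝ) • 1).det
  set N := noiseEnergy k (fun j : Fin t => z j) (fun j : Fin t => e j)
  have hD : 0 < √D := Real.sqrt_pos.2 hdet
  have h1 : Real.exp (N / (2 * R ^ 2)) ≤ √D / δ := by
    rw [inv_mul_lt_iff₀ hD] at h
    exact h.le
  have h2 : N / (2 * R ^ 2) ≤ Real.log (√D / δ) :=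
    (Real.le_log_iff_exp_le (by positivity)).2 h1
  rw [div_le_iff₀ (by positivity)] at h2
  calc √N ≤ √(R ^ 2 * (2 * Real.log (√D / δ))) := Real.sqrt_le_sqrt (by linarith)
    _ = _ := by rw [Real.sqrt_mul (by positivity), Real.sqrt_sq hR.le]

end Confidence

/-! ### Information gain and its dependence on the regularization -/

section InformationGain

variable {X H : Type*} [NormedAddCommGroup H] [InnerProductSpace ℝ H]
  {k : X → X → ℝ} {Φ : X → H}

/-- Posterior variance at `z i` given the previous points `z 0, …, z (i - 1)`. -/
noncomputable def seqVar (k : X → X → ℝ) (lam : ℝ) (z : ℕ → X) (i : ℕ) : ℝ :=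
  postCov k lam (fun j : Fin i => z j) (z i) (z i)

theorem det_kernelMatrix_add_eq_prod (hk : ∀ x y, k x y = inner ℝ (Φ x) (Φ y)) (z : ℕ → X) (n : ℕ)
    {lam : ℝ} (hlam : 0 < lam) :
    (kernelMatrix k (fun j : Fin n => z j) + lam • 1).det =
      ∏ i ∈ Finset.range n, (lam + seqVar k lam z i) := by
  induction n with
  | zero => simp
  | succ n ih => rw [det_kernelMatrix_succ hk z n hlam, ih, Finset.prod_range_succ, seqVar]

theorem det_kernelMatrix_add_mono (hk : ∀ x y, k x y = inner ℝ (Φ x) (Φ y)) (z : ℕ → X) (n : ℕ)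
    {lam lam' : ℝ} (hlam : 0 < lam) (h : lam ≤ lam') :
    (kernelMatrix k (fun j : Fin n => z j) + lam • 1).det ≤
      (kernelMatrix k (fun j : Fin n => z j) + lam' • 1).det := by
  rw [det_kernelMatrix_add_eq_prod hk z n hlam,
    det_kernelMatrix_add_eq_prod hk z n (hlam.trans_le h)]
  exact Finset.prod_le_prod
    (fun i _ => add_nonneg hlam.le (postCov_self_nonneg hk _ hlam _))
    fun i _ => add_le_add h (postCov_self_mono hk _ hlam h _)

/-- The chain rule for mutual information, read off from the product formula for the determinant. -/
theorem infoGain_eq_sum (hk : ∀ x y, k x y = inner ℝ (Φ x) (Φ y)) (z : ℕ → X) (n : ℕ)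
    {lam : ℝ} (hlam : 0 < lam) :
    infoGain k lam (fun j : Fin n => z j) =
      (∑ i ∈ Finset.range n, Real.log (1 + lam⁻¹ * seqVar k lam z i)) / 2 := by
  have h1 : 1 + lam⁻¹ • kernelMatrix k (fun j : Fin n => z j) =
      lam⁻¹ • (kernelMatrix k (fun j : Fin n => z j) + lam • 1) := by
    rw [smul_add, smul_smul, inv_mul_cancel₀ hlam.ne', one_smul, add_comm]
  have h2 : ∀ i, lam⁻¹ * (lam + seqVar k lam z i) = 1 + lam⁻¹ * seqVar k lam z i := fun i => by
    rw [mul_add, inv_mul_cancel₀ hlam.ne']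
  rw [infoGain, h1, det_smul, det_kernelMatrix_add_eq_prod hk z n hlam, Fintype.card_fin,
    ← Finset.card_range n, ← Finset.prod_const, Finset.card_range, ← Finset.prod_mul_distrib]
  simp only [h2]
  rw [Real.log_prod fun i _ => ?_]
  have := postCov_self_nonneg hk (fun j : Fin i => z j) hlam (z i)
  have : 0 ≤ lam⁻¹ * seqVar k lam z i := mul_nonneg (inv_nonneg.2 hlam.le) this
  positivity

/-- Termwise comparison in the chain rule. For `s ≤ lam` the scaled variances are already ordered;
for `lam ≤ s` Bernoulli's inequality `1 + r t ≤ (1 + t) ^ r` with `r = s / lam` costs the factor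
`r`. This lets a growth bound for one fixed `s` serve every regularization. -/
theorem infoGain_le_mul (hk : ∀ x y, k x y = inner ℝ (Φ x) (Φ y)) (z : ℕ → X) (n : ℕ)
    {lam s : ℝ} (hlam : 0 < lam) (hs : 0 < s) :
    infoGain k lam (fun j : Fin n => z j) ≤
      max 1 (s / lam) * infoGain k s (fun j : Fin n => z j) := by
  rw [infoGain_eq_sum hk z n hlam, infoGain_eq_sum hk z n hs, ← mul_div_assoc, Finset.mul_sum]
  gcongr with i _
  have h0 : ∀ {t : ℝ}, 0 < t → 0 ≤ t⁻¹ * seqVar k t z i := fun ht =>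
    mul_nonneg (inv_nonneg.2 ht.le) (postCov_self_nonneg hk _ ht _)
  rcases le_total s lam with h | h
  · rw [max_eq_left ((div_le_one hlam).2 h), one_mul]
    refine Real.log_le_log (by linarith [h0 hlam]) ?_
    have := inv_mul_postCov_self_antitone hk (fun j : Fin i => z j) hs h (z i)
    simpa [seqVar] using this
  · have h1 : 1 ≤ s / lam := (one_le_div hlam).2 h
    rw [max_eq_right h1]
    have h2 : 1 + lam⁻¹ * seqVar k lam z i ≤ (1 + s⁻¹ * seqVar k s z i) ^ (s / lam) := by
      refine le_trans ?_ (one_add_mul_self_le_rpow_one_add (by linarith [h0 hs]) h1)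
      have h3 : s / lam * (s⁻¹ * seqVar k s z i) = lam⁻¹ * seqVar k s z i := by
        field_simp
      rw [h3]
      have := postCov_self_mono hk (fun j : Fin i => z j) hlam h (z i)
      gcongr
      exact this
    rw [← Real.log_rpow (by linarith [h0 hs])]
    exact Real.log_le_log (by linarith [h0 hlam]) h2

/-- Factoring `c = 1 + 2 / n` out of the determinant costs `n log c ≤ n (c - 1) = 2`, so the
inflation in `beta` adds only a constant. -/
theorem log_det_inflated_le (hk : ∀ x y, k x y = inner ℝ (Φ x) (Φ y)) (z : ℕ → X) {n : ℕ}
    (hn : 1 ≤ n) {s : ℝ} (hs : 0 < s) :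
    Real.log (kernelMatrix k (fun j : Fin n => z j) + (1 + 2 / (n : ℝ)) • 1).det ≤
      2 + 2 * (max 1 s * infoGain k s (fun j : Fin n => z j)) := by
  have hn0 : (0 : ℝ) < n := by exact_mod_cast hn
  set c : ℝ := 1 + 2 / (n : ℝ) with hc
  have hc1 : 1 ≤ c := by rw [hc]; linarith [div_pos two_pos hn0]
  have hc0 : 0 < c := one_pos.trans_le hc1
  have h0 : ∀ i, 0 ≤ seqVar k c z i := fun i => postCov_self_nonneg hk _ hc0 _
  have h1 : Real.log (kernelMatrix k (fun j : Fin n => z j) + c • 1).det =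
      n * Real.log c + 2 * infoGain k c (fun j : Fin n => z j) := by
    rw [det_kernelMatrix_add_eq_prod hk z n hc0, infoGain_eq_sum hk z n hc0,
      Real.log_prod fun i _ => (add_pos_of_pos_of_nonneg hc0 (h0 i)).ne',
      mul_div_cancel₀ _ two_ne_zero]
    have h2 : ∀ i ∈ Finset.range n, Real.log (c + seqVar k c z i) =
        Real.log c + Real.log (1 + c⁻¹ * seqVar k c z i) := fun i _ => by
      have : 0 ≤ c⁻¹ * seqVar k c z i := mul_nonneg (inv_nonneg.2 hc0.le) (h0 i)
      rw [← Real.log_mul hc0.ne' (by positivity)]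
      congr 1
      field_simp
    rw [Finset.sum_congr rfl h2, Finset.sum_add_distrib]
    simp
  have h2 : n * Real.log c ≤ 2 := by
    have := Real.log_le_sub_one_of_pos hc0
    calc n * Real.log c ≤ n * (c - 1) := by gcongr
      _ = 2 := by rw [hc]; field_simp; ring
  have hpos : 0 ≤ infoGain k s (fun j : Fin n => z j) := by
    rw [infoGain_eq_sum hk z n hs]
    refine div_nonneg (Finset.sum_nonneg fun i _ => Real.log_nonneg ?_) zero_le_two
    have := mul_nonneg (inv_nonneg.2 hs.le) (postCov_self_nonneg hk (fun j : Fin i => z j) hs (z i))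
    exact le_add_of_nonneg_right this
  have h3 : infoGain k c (fun j : Fin n => z j) ≤
      max 1 s * infoGain k s (fun j : Fin n => z j) := by
    refine (infoGain_le_mul hk z n hc0 hs).trans ?_
    gcongr
    exact div_le_self hs.le hc1
  linarith

end InformationGain

/-- An exponent `q` strictly between `max p 0` and `1 / 2` absorbs the logarithm and is positive
even if `p` is not. -/
theorem InfoGainGrowth.exists_rpow_bound {X : Type*} {k : X → X → ℝ} (h : InfoGainGrowth k) :
    ∃ s : ℝ, 0 < s ∧ ∃ D q : ℝ, 0 ≤ D ∧ 0 < q ∧ q < 1 / 2 ∧ ∃ N : ℕ, ∀ n ≥ N, ∀ x : Fin n → X,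
      infoGain k s x ≤ D * (n : ℝ) ^ q := by
  obtain ⟨s, hs, C, p, hp, hev⟩ := h
  obtain ⟨q, hq, hq2⟩ : ∃ q, max p 0 < q ∧ q < 1 / 2 := exists_between (max_lt hp (by norm_num))
  have hpq : p < q := (le_max_left _ _).trans_lt hq
  have hlog := (((isLittleO_log_rpow_atTop (sub_pos.2 hpq)).bound one_pos).natCast_atTop).and
    (hev.and (Filter.eventually_ge_atTop 1))
  obtain ⟨N, hN⟩ := Filter.eventually_atTop.1 hlog
  refine ⟨s, hs, |C|, q, abs_nonneg C, (le_max_right _ _).trans_lt hq, hq2, N, fun n hn x => ?_⟩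
  obtain ⟨h1, h2, h3⟩ := hN n hn
  have hn0 : (0 : ℝ) < n := by exact_mod_cast h3
  have h4 : infoGain k s x ≤ C * ((n : ℝ) ^ p * Real.log n) :=
    EReal.coe_le_coe_iff.1 ((le_iSup (fun x : Fin n → X => (infoGain k s x : EReal)) x).trans h2)
  have hlog0 : 0 ≤ Real.log n := Real.log_natCast_nonneg n
  have hpow : (0 : ℝ) < (n : ℝ) ^ (q - p) := Real.rpow_pos_of_pos hn0 _
  rw [one_mul, Real.norm_of_nonneg hlog0, Real.norm_of_nonneg hpow.le] at h1
  calc infoGain k s x ≤ C * ((n : ℝ) ^ p * Real.log n) := h4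
    _ ≤ |C| * ((n : ℝ) ^ p * (n : ℝ) ^ (q - p)) := by
        have := le_abs_self C
        gcongr
    _ = |C| * (n : ℝ) ^ q := by rw [← Real.rpow_add hn0]; ring_nf

/-! ### Termination -/

section Termination

variable {X H : Type*} [NormedAddCommGroup H] [InnerProductSpace ℝ H] {Φ : X → H}

theorem Params.beta_eq (p : Params X) (z : ℕ → X) (i : ℕ) :
    p.beta z i = p.B + p.R * √(2 * Real.log
      (√(kernelMatrix p.k (fun j : Fin i => z j) + (1 + 2 / (i : ℝ)) • 1).det / p.δ)) := by
  rw [Params.beta, add_comm ((1 + 2 / (i : ℝ)) • (1 : Matrix (Fin i) (Fin i) ℝ))]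

theorem Params.beta_sq_le (p : Params X) (hk : ∀ x y, p.k x y = inner ℝ (Φ x) (Φ y)) (z : ℕ → X)
    {i : ℕ} (hi : 1 ≤ i) {s : ℝ} (hs : 0 < s) :
    p.beta z i ^ 2 ≤ 2 * p.B ^ 2 + 2 * p.R ^ 2 *
      (2 + 2 * (max 1 s * infoGain p.k s (fun j : Fin i => z j)) - 2 * Real.log p.δ) := by
  have hi0 : (0 : ℝ) < i := by exact_mod_cast hi
  have hc : (1 : ℝ) ≤ 1 + 2 / (i : ℝ) := by linarith [div_pos two_pos hi0]
  have hlog := log_det_inflated_le hk z hi hs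
  have hdet1 : (1 : ℝ) ≤ (kernelMatrix p.k (fun j : Fin i => z j) + (1 + 2 / (i : ℝ)) • 1).det := by
    refine le_trans ?_ (det_kernelMatrix_add_mono hk z i one_pos hc)
    rw [det_kernelMatrix_add_eq_prod hk z i one_pos]
    calc (1 : ℝ) = ∏ _j ∈ Finset.range i, 1 := by simp
      _ ≤ _ := Finset.prod_le_prod (fun _ _ => zero_le_one) fun j _ =>
        le_add_of_nonneg_right (postCov_self_nonneg hk _ one_pos _)
  rw [p.beta_eq]
  set D := (kernelMatrix p.k (fun j : Fin i => z j) + (1 + 2 / (i : ℝ)) • 1).det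
  have hD : 0 < √D := Real.sqrt_pos.2 (one_pos.trans_le hdet1)
  have h1 : Real.log (√D / p.δ) = Real.log D / 2 - Real.log p.δ := by
    rw [Real.log_div hD.ne' p.δ_pos.ne', Real.log_sqrt (by positivity)]
  -- Since `D ≥ 1` and `δ ≤ 1`, the square root in `beta` is not truncated at 0 and may be squared.
  have h2 : 0 ≤ 2 * Real.log (√D / p.δ) := by
    rw [h1]
    linarith [Real.log_nonneg hdet1, Real.log_nonpos p.δ_pos.le p.δ_le_one]
  have h3 := Real.sq_sqrt h2
  set r := √(2 * Real.log (√D / p.δ))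
  calc (p.B + p.R * r) ^ 2 ≤ 2 * p.B ^ 2 + 2 * p.R ^ 2 * r ^ 2 := by
        nlinarith [sq_nonneg (p.B - p.R * r)]
    _ ≤ _ := by
        rw [h3, h1]
        gcongr
        linarith

/-- No infinite sequence of sample points keeps the regret bound above the tolerance. -/
theorem Params.exists_regretBound_le (p : Params X) (hk : ∀ x y, p.k x y = inner ℝ (Φ x) (Φ y))
    (hgrowth : InfoGainGrowth p.k) (hreg : BddAbove (Set.range p.reg)) (z : ℕ → X) :
    ∃ i : ℕ, 1 ≤ i ∧ p.regretBound z i ≤ p.ε := by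
  by_contra! hcon
  obtain ⟨lam, hlam⟩ := hreg
  have hreg_le : ∀ i, p.reg i ≤ lam := fun i => hlam ⟨i, rfl⟩
  have hreg_pos : ∀ i, 0 < p.reg i := fun i => one_pos.trans_le (p.one_le_reg i)
  have hlam0 : 0 < lam := (hreg_pos 0).trans_le (hreg_le 0)
  obtain ⟨s, hs, D, q, hD, hq, hq2, N, hN⟩ := hgrowth.exists_rpow_bound
  set E := 2 * p.B ^ 2 + 2 * p.R ^ 2 * (2 + 2 * (max 1 s * D) - 2 * Real.log p.δ) with hE
  have hlogδ := Real.log_nonpos p.δ_pos.le p.δ_le_one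
  have hB := p.B_pos
  have hR := p.R_pos
  have hε := p.ε_pos
  have hM : 0 < max 1 s := by positivity
  have hin : 0 ≤ 2 + 2 * (max 1 s * D) - 2 * Real.log p.δ := by
    have : 0 ≤ max 1 s * D := by positivity
    linarith
  have hE0 : 0 < E := by positivity
  -- Up to constants, `beta ^ 2` grows no faster than the information gain.
  have hbeta : ∀ i, 1 ≤ i → N ≤ i → p.beta z i ^ 2 ≤ E * (i : ℝ) ^ q := by
    intro i hi hNi
    have hiq : (1 : ℝ) ≤ (i : ℝ) ^ q := Real.one_le_rpow (by exact_mod_cast hi) hq.le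
    refine (p.beta_sq_le hk z hi hs).trans ?_
    have h1 := hN i hNi (fun j : Fin i => z j)
    have h2 : max 1 s * infoGain p.k s (fun j : Fin i => z j) ≤ max 1 s * D * (i : ℝ) ^ q := by
      rw [mul_assoc]
      gcongr
    have h3 : 2 + 2 * (max 1 s * infoGain p.k s (fun j : Fin i => z j)) - 2 * Real.log p.δ ≤
        (2 + 2 * (max 1 s * D) - 2 * Real.log p.δ) * (i : ℝ) ^ q := by
      nlinarith
    calc _ ≤ 2 * p.B ^ 2 + 2 * p.R ^ 2 *
          ((2 + 2 * (max 1 s * D) - 2 * Real.log p.δ) * (i : ℝ) ^ q) := by gcongr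
      _ ≤ 2 * p.B ^ 2 * (i : ℝ) ^ q + 2 * p.R ^ 2 *
          ((2 + 2 * (max 1 s * D) - 2 * Real.log p.δ) * (i : ℝ) ^ q) := by
          exact add_le_add (le_mul_of_one_le_right (by positivity) hiq) le_rfl
      _ = E * (i : ℝ) ^ q := by rw [hE]; ring
  set a := p.ε ^ 2 / (4 * E * lam) with ha
  have ha0 : 0 < a := by positivity
  -- The failed test `ε < 2 β σ`, squared, bounds the variance from below; raising each `reg i` to
  -- the common bound `lam` only increases it and makes the chain rule available.
  have hvar : ∀ i, 1 ≤ i → N ≤ i → a / (i : ℝ) ^ q ≤ lam⁻¹ * seqVar p.k lam z i := by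
    intro i hi hNi
    have hiq : (0 : ℝ) < (i : ℝ) ^ q := Real.rpow_pos_of_pos (by exact_mod_cast hi) _
    have h1 := hcon i hi
    rw [Params.regretBound] at h1
    have hcov := postCov_self_nonneg hk (fun j : Fin i => z j) (hreg_pos i) (z i)
    have h2 : p.std z i (z i) ^ 2 ≤ seqVar p.k lam z i :=
      (Real.sq_sqrt hcov).trans_le
        (postCov_self_mono hk (fun j : Fin i => z j) (hreg_pos i) (hreg_le i) (z i))
    have h3 : p.ε ^ 2 ≤ 4 * (E * (i : ℝ) ^ q) * seqVar p.k lam z i := by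
      calc p.ε ^ 2 ≤ (2 * p.beta z i * p.std z i (z i)) ^ 2 := by gcongr
        _ = 4 * p.beta z i ^ 2 * p.std z i (z i) ^ 2 := by ring
        _ ≤ 4 * (E * (i : ℝ) ^ q) * seqVar p.k lam z i := by
            gcongr
            exact hbeta i hi hNi
    rw [ha, div_div, div_le_iff₀ (by positivity)]
    calc p.ε ^ 2 ≤ 4 * (E * (i : ℝ) ^ q) * seqVar p.k lam z i := h3
      _ = _ := by field_simp
  set N' := max N 1 with hN'
  set M := max 1 (s / lam) with hMdef
  have hlog_nonneg : ∀ i, 0 ≤ Real.log (1 + lam⁻¹ * seqVar p.k lam z i) := fun i =>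
    Real.log_nonneg (le_add_of_nonneg_right
      (mul_nonneg (inv_nonneg.2 hlam0.le) (postCov_self_nonneg hk _ hlam0 _)))
  -- The information gain at time `T` is at least of order `T ^ (1 - q)` and at most of order `T ^
  -- q`.
  have hkey : ∀ T : ℕ, N' ≤ T →
      ((T : ℝ) - N') * (a / ((1 + a) * (T : ℝ) ^ q)) ≤ 2 * (M * (D * (T : ℝ) ^ q)) := by
    intro T hT
    have hT1 : 1 ≤ T := (le_max_right _ _).trans hT
    have hTq : (1 : ℝ) ≤ (T : ℝ) ^ q := Real.one_le_rpow (by exact_mod_cast hT1) hq.le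
    calc ((T : ℝ) - N') * (a / ((1 + a) * (T : ℝ) ^ q))
        = ∑ _i ∈ Finset.Ico N' T, a / ((1 + a) * (T : ℝ) ^ q) := by
          rw [Finset.sum_const, Nat.card_Ico, nsmul_eq_mul, Nat.cast_sub hT]
      _ ≤ ∑ i ∈ Finset.Ico N' T, Real.log (1 + lam⁻¹ * seqVar p.k lam z i) := by
          refine Finset.sum_le_sum fun i hi => ?_
          obtain ⟨hi1, hi2⟩ := Finset.mem_Ico.1 hi
          have hi1' : 1 ≤ i := (le_max_right _ _).trans hi1
          have hi0 : (0 : ℝ) < i := by exact_mod_cast hi1'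
          have hiq : (0 : ℝ) < (i : ℝ) ^ q := Real.rpow_pos_of_pos hi0 _
          have hiT : (i : ℝ) ^ q ≤ (T : ℝ) ^ q :=
            Real.rpow_le_rpow hi0.le (by exact_mod_cast hi2.le) hq.le
          have h1 : a / (T : ℝ) ^ q ≤ lam⁻¹ * seqVar p.k lam z i :=
            (by gcongr : a / (T : ℝ) ^ q ≤ a / (i : ℝ) ^ q).trans
              (hvar i hi1' ((le_max_left _ _).trans hi1))
          have h2 : 0 < 1 + a / (T : ℝ) ^ q := by positivity
          -- Since `T ^ q ≥ 1`, the denominator `T ^ q + a` is at most `(1 + a) * T ^ q`.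
          calc a / ((1 + a) * (T : ℝ) ^ q) ≤ a / ((T : ℝ) ^ q + a) := by
                gcongr
                nlinarith
            _ = 1 - (1 + a / (T : ℝ) ^ q)⁻¹ := by field_simp; ring
            _ ≤ Real.log (1 + a / (T : ℝ) ^ q) := Real.one_sub_inv_le_log_of_pos h2
            _ ≤ _ := Real.log_le_log h2 (by linarith)
      _ ≤ ∑ i ∈ Finset.range T, Real.log (1 + lam⁻¹ * seqVar p.k lam z i) := by
          refine Finset.sum_le_sum_of_subset_of_nonneg (fun i hi => ?_) fun i _ _ => hlog_nonneg i
          exact Finset.mem_range.2 (Finset.mem_Ico.1 hi).2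
      _ = 2 * infoGain p.k lam (fun j : Fin T => z j) := by
          rw [infoGain_eq_sum hk z T hlam0]
          ring
      _ ≤ 2 * (M * infoGain p.k s (fun j : Fin T => z j)) := by
          gcongr
          exact infoGain_le_mul hk z T hlam0 hs
      _ ≤ _ := by
          gcongr
          exact hN T ((le_max_left _ _).trans hT) _
  set c := 2 * (M * D) * ((1 + a) / a) with hc
  -- Divided by `T`, the comparison has a right side tending to 0, because `2 * q < 1`.
  have hfin : ∀ T : ℕ, N' ≤ T → 1 ≤ c * (T : ℝ) ^ (-(1 - 2 * q)) + N' * (T : ℝ)⁻¹ := by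
    intro T hT
    have hT0 : (0 : ℝ) < T := by exact_mod_cast (le_max_right N 1).trans hT
    have hTq : (0 : ℝ) < (T : ℝ) ^ q := Real.rpow_pos_of_pos hT0 _
    have h1 := hkey T hT
    have h2 : (T : ℝ) - N' ≤ c * ((T : ℝ) ^ q * (T : ℝ) ^ q) := by
      rw [← mul_div_assoc, div_le_iff₀ (by positivity)] at h1
      rw [hc]
      refine le_of_mul_le_mul_right (h1.trans_eq ?_) ha0
      field_simp
    have h3 : (T : ℝ) ^ (-(1 - 2 * q)) = (T : ℝ) ^ q * (T : ℝ) ^ q * (T : ℝ)⁻¹ := by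
      rw [← Real.rpow_add hT0, ← Real.rpow_neg_one, ← Real.rpow_add hT0]
      ring_nf
    rw [h3]
    have h4 := mul_le_mul_of_nonneg_right h2 (inv_nonneg.2 hT0.le)
    rw [sub_mul, mul_inv_cancel₀ hT0.ne'] at h4
    linarith
  have hlim : Filter.Tendsto (fun T : ℕ => c * (T : ℝ) ^ (-(1 - 2 * q)) + N' * (T : ℝ)⁻¹)
      Filter.atTop (nhds (c * 0 + N' * 0)) :=
    (((tendsto_rpow_neg_atTop (by linarith)).comp tendsto_natCast_atTop_atTop).const_mul c).add
      (tendsto_inv_atTop_nhds_zero_nat.const_mul _)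
  have := ge_of_tendsto hlim (Filter.eventually_atTop.2 ⟨N', hfin⟩)
  norm_num at this

end Termination

/-! ### Correctness of a single run -/

/-- If the self-normalized noise process stays below `1 / δ`, then the GP confidence intervals
with half-width `β_i σ_{i-1}` contain `J`. -/
theorem abs_sub_mean_le {X : Type*} {p : Params X} {J : X → ℝ}
    (hJ : RKHSNormLE p.k J p.B) {z : ℕ → X} {e : ℕ → ℝ} {i : ℕ} (hi : 1 ≤ i)
    (h : selfNormalized p.k p.R z e i < ENNReal.ofReal p.δ⁻¹) (a : X) :
    |J a - p.mean z (fun n => J (z n) + e n) i a| ≤ p.beta z i * p.std z i a := by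
  obtain ⟨H, _, _, Φ, hk, f, hf, hB⟩ := hJ.exists_featureMap
  refine (abs_sub_postMean_le hk hf hB (fun j : Fin i => z j) (p.one_le_reg i) a
    (fun j : Fin i => e j)).trans ?_
  refine mul_le_mul_of_nonneg_right ?_ (Real.sqrt_nonneg _)
  rw [p.beta_eq]
  refine add_le_add le_rfl
    ((sqrt_noiseEnergy_le_of_selfNormalized_lt hk p.R_pos p.δ_pos h).trans ?_)
  -- The tail bound involves `det (K + I)`; the inflated determinant in `beta` dominates it.
  have hi0 : (0 : ℝ) < i := by exact_mod_cast hi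
  have hdet := (posDef_kernelMatrix_add_smul_one hk (fun j : Fin i => z j) one_pos).det_pos
  have hmono := det_kernelMatrix_add_mono hk z i one_pos
    (by linarith [div_pos two_pos hi0] : (1 : ℝ) ≤ 1 + 2 / (i : ℝ))
  have hδ := p.δ_pos
  have hR := p.R_pos
  gcongr

section Run

variable {X Ω : Type*} [MeasurableSpace X] [MeasurableSpace Ω] {p : Params X} {J : X → ℝ}
  {P : Measure Ω}

theorem Run.terminates_of_infoGainGrowth (r : Run p J P) (hJ : RKHSNormLE p.k J p.B)
    (hgrowth : InfoGainGrowth p.k) (hreg : BddAbove (Set.range p.reg)) (ω : Ω) :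
    r.Terminates ω := by
  obtain ⟨H, _, _, Φ, hk, -⟩ := hJ.exists_featureMap
  exact p.exists_regretBound_le hk hgrowth hreg (r.points ω)

/-- On the event that the confidence intervals are valid, the output is an upper bound of `J`
that is attained up to the tolerance. -/
theorem Run.output_spec (r : Run p J P) (hJ : RKHSNormLE p.k J p.B) {ω : Ω}
    (hmax : ∀ i : ℕ, 1 ≤ i →
      (∀ j : ℕ, 1 ≤ j → j < i → p.ε < p.regretBound (fun n => r.z n ω) j) →
      ∀ a : X,
        p.ucb (fun n => r.z n ω) (fun n => J (r.z n ω) + r.ξ n ω) i a ≤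
          p.ucb (fun n => r.z n ω) (fun n => J (r.z n ω) + r.ξ n ω) i (r.z i ω))
    (hnoise : ∀ t, selfNormalized p.k p.R (fun j => r.z j ω) (fun j => r.ξ j ω) t <
      ENNReal.ofReal p.δ⁻¹)
    (hterm : r.Terminates ω) :
    (∀ a, J a ≤ r.output ω) ∧ ∃ a, r.output ω ≤ J a + p.ε := by
  obtain ⟨hi, hregret⟩ : 1 ≤ r.stopIter ω ∧ p.regretBound (r.points ω) (r.stopIter ω) ≤ p.ε :=
    Nat.sInf_mem hterm
  -- `stopIter` is the first success, so all earlier tests failed and its point still maximizes the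
  -- acquisition function.
  have hbefore : ∀ j : ℕ, 1 ≤ j → j < r.stopIter ω → p.ε < p.regretBound (r.points ω) j :=
    fun j hj hlt => not_le.1 fun h => Nat.notMem_of_lt_sInf hlt ⟨hj, h⟩
  have hconf := fun a => abs_le.1 (abs_sub_mean_le hJ hi (hnoise (r.stopIter ω)) a)
  have hout : r.output ω = p.mean (r.points ω) (r.meas ω) (r.stopIter ω)
      (r.points ω (r.stopIter ω)) + p.beta (r.points ω) (r.stopIter ω) *
        p.std (r.points ω) (r.stopIter ω) (r.points ω (r.stopIter ω)) := rfl
  refine ⟨fun a => ?_, r.points ω (r.stopIter ω), ?_⟩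
  · refine le_trans ?_ (hmax _ hi hbefore a)
    have := (hconf a).2
    rw [Params.ucb]
    linarith
  · have h1 : -(p.beta (r.points ω) (r.stopIter ω) *
        p.std (r.points ω) (r.stopIter ω) (r.points ω (r.stopIter ω))) ≤
        J (r.points ω (r.stopIter ω)) - p.mean (r.points ω) (r.meas ω) (r.stopIter ω)
          (r.points ω (r.stopIter ω)) := (hconf (r.points ω (r.stopIter ω))).1
    rw [Params.regretBound] at hregret
    rw [hout]
    linarith

/-- With probability at least `1 - δ` the output of a terminating run is correct; the event is
measurable in the data of the run. -/
theorem Run.exists_measurableSet_output_spec [IsProbabilityMeasure P] (r : Run p J P)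
    (hkm : Measurable fun q : X × X => p.k q.1 q.2) (hJ : RKHSNormLE p.k J p.B) :
    ∃ G : Set (ℕ → X × ℝ), MeasurableSet G ∧
      ENNReal.ofReal (1 - p.δ) ≤ P ((fun ω (i : ℕ) => (r.z i ω, r.ξ i ω)) ⁻¹' G) ∧
      ∀ᵐ ω ∂P, (fun i : ℕ => (r.z i ω, r.ξ i ω)) ∈ G → r.Terminates ω →
        (∀ a, J a ≤ r.output ω) ∧ ∃ a, r.output ω ≤ J a + p.ε := by
  -- The good event is formed in the space of data sequences, where independence of the two runs can
  -- be applied.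
  have hmeas : ∀ t, Measurable fun q : ℕ → X × ℝ =>
      selfNormalized p.k p.R (fun j => (q j).1) (fun j => (q j).2) t := fun t =>
    measurable_selfNormalized hkm p.R (z := fun j (q : ℕ → X × ℝ) => (q j).1)
      (e := fun j (q : ℕ → X × ℝ) => (q j).2) (fun j _ => (measurable_pi_apply j).fst)
      (fun j _ => (measurable_pi_apply j).snd)
  have hG : MeasurableSet {q : ℕ → X × ℝ | ∀ t,
      selfNormalized p.k p.R (fun j => (q j).1) (fun j => (q j).2) t < ENNReal.ofReal p.δ⁻¹} := by
    rw [Set.ofPred_forall]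
    exact MeasurableSet.iInter fun t => hmeas t measurableSet_Iio
  have hdata : Measurable fun ω (i : ℕ) => (r.z i ω, r.ξ i ω) :=
    measurable_pi_lambda _ fun i => (r.measurable_z i).prodMk (r.measurable_ξ i)
  refine ⟨_, hG, ?_, ?_⟩
  · obtain ⟨H, _, _, Φ, hk, -⟩ := hJ.exists_featureMap
    have h := measure_exists_le_selfNormalized hk hkm p.R_pos p.δ_pos r.measurable_z
      r.measurable_ξ r.subGaussian
    have hcompl := prob_compl_eq_one_sub (μ := P) (hdata hG).compl
    rw [compl_compl] at hcompl
    rw [hcompl, ENNReal.ofReal_sub _ p.δ_pos.le, ENNReal.ofReal_one]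
    refine tsub_le_tsub_left (le_trans (measure_mono fun ω hω => ?_) h) _
    simpa using hω
  · filter_upwards [r.isMax] with ω hmax hω hterm
    exact r.output_spec hJ hmax hω hterm

end Run

/-! ### From the simulator to the true system -/

section Robustness

variable {n m l : ℕ} {𝒳 : Set (EuclideanSpace ℝ (Fin n))}
  {𝒰 : Set (EuclideanSpace ℝ (Fin m))} {𝒟 : Set (EuclideanSpace ℝ (Fin l))}
  {W W' : Type*} [MeasurableSpace W] [MeasurableSpace W']
  {S : ControlSystem 𝒳 𝒰 𝒟 W} {S' : ControlSystem 𝒳 𝒰 𝒟 W'}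
  {x₀ x₀' : EuclideanSpace ℝ (Fin n)}
  {Θ Θ' : Type*} [MeasurableSpace Θ] [MeasurableSpace Θ']
  {ρ : (ℝ≥0 → EuclideanSpace ℝ (Fin n)) → ℝ}

/-- Both expectations are integrals over the product law, so their difference is bounded by the
integral of the absolute difference. -/
theorem abs_expRobustness_sub_le_expGap {real : ClosedLoop S x₀ Θ} {sim : ClosedLoop S' x₀' Θ'}
    (h_real : HasExpectedRobustness ρ real) (h_sim : HasExpectedRobustness ρ sim) (d : 𝒟) :
    |expRobustness ρ real d - expRobustness ρ sim d| ≤ expGap ρ real sim d := by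
  have := real.isProb_law d
  have := sim.isProb_law d
  have h1 : expRobustness ρ real d =
      ∫ q, ρ (real.φ d q.1) ∂(real.law d).prod (sim.law d) := by
    rw [integral_fun_fst (fun θ => ρ (real.φ d θ)), probReal_univ, one_smul, expRobustness]
  have h2 : expRobustness ρ sim d =
      ∫ q, ρ (sim.φ d q.2) ∂(real.law d).prod (sim.law d) := by
    rw [integral_fun_snd (fun θ => ρ (sim.φ d θ)), probReal_univ, one_smul, expRobustness]
  rw [h1, h2, ← integral_sub ((h_real d).comp_fst _) ((h_sim d).comp_snd _)]
  exact abs_integral_le_integral_abs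

theorem expGap_nonneg (ρ : (ℝ≥0 → EuclideanSpace ℝ (Fin n)) → ℝ) (real : ClosedLoop S x₀ Θ)
    (sim : ClosedLoop S' x₀' Θ') (d : 𝒟) : 0 ≤ expGap ρ real sim d :=
  integral_nonneg fun _ => abs_nonneg _

/-- Bounds on the minimum expected robustness of the true system from a nearly minimal value `r`
for the simulator and an upper bound `e` of the gap. -/
theorem minExpRobustness_mem_Icc {real : ClosedLoop S x₀ Θ} {sim : ClosedLoop S' x₀' Θ'}
    (h_real : HasExpectedRobustness ρ real) (h_sim : HasExpectedRobustness ρ sim) {r e ε : ℝ}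
    (hr : ∀ d, r ≤ expRobustness ρ sim d) (hr' : ∃ d, expRobustness ρ sim d ≤ r + ε)
    (he : ∀ d, expGap ρ real sim d ≤ e) :
    minExpRobustness ρ real ∈ Set.Icc (r - e) (r + ε + e) := by
  have hgap := fun d => abs_le.1 (abs_expRobustness_sub_le_expGap h_real h_sim d)
  obtain ⟨d, hd⟩ := hr'
  have : Nonempty 𝒟 := ⟨d⟩
  -- Besides the lower estimate, this gives the boundedness below without which the real infimum
  -- would be a default value.
  have hlower : ∀ d, r - e ≤ expRobustness ρ real d := fun d => by
    linarith [hr d, he d, (hgap d).1]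
  refine ⟨le_ciInf hlower, (ciInf_le ⟨r - e, ?_⟩ d).trans ?_⟩
  · rintro _ ⟨d, rfl⟩
    exact hlower d
  · linarith [he d, (hgap d).2]

end Robustness

/-- Only the data events `s` and `t` must be measurable; the target event `A` merely contains their
intersection almost surely, so no measurability of outputs or stopping times is needed. -/
theorem ofReal_mul_le_measure_of_indepFun {Ω β β' : Type*} [MeasurableSpace Ω]
    [MeasurableSpace β] [MeasurableSpace β'] {P : Measure Ω} {f : Ω → β} {g : Ω → β'}
    (h : IndepFun f g P) {s : Set β} {t : Set β'} (hs : MeasurableSet s) (ht : MeasurableSet t)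
    {a b : ℝ} (ha : 0 ≤ a) (hsa : ENNReal.ofReal a ≤ P (f ⁻¹' s))
    (htb : ENNReal.ofReal b ≤ P (g ⁻¹' t)) {A : Set Ω}
    (hA : ∀ᵐ ω ∂P, f ω ∈ s → g ω ∈ t → ω ∈ A) : ENNReal.ofReal (a * b) ≤ P A := by
  rw [ENNReal.ofReal_mul ha]
  refine (mul_le_mul' hsa htb).trans ?_
  rw [← h.measure_inter_preimage_eq_mul s t hs ht]
  refine measure_mono_ae ?_
  filter_upwards [hA] with ω hω hmem
  exact hω hmem.1 hmem.2

end Sim2Real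

/-! ### Combination of the two runs -/

theorem theorem2
    {n m l : ℕ} {𝒳 : Set (EuclideanSpace ℝ (Fin n))}
    {𝒰 : Set (EuclideanSpace ℝ (Fin m))} {𝒟 : Set (EuclideanSpace ℝ (Fin l))}
    -- the decision space of both optimization problems
    (h𝒟_compact : IsCompact 𝒟) (h𝒟_convex : Convex ℝ 𝒟)
    -- the true system and the simulator, with their closed-loop trajectories
    {W W' : Type*} [MeasurableSpace W] [MeasurableSpace W']
    {S : Sim2Real.ControlSystem 𝒳 𝒰 𝒟 W} {S' : Sim2Real.ControlSystem 𝒳 𝒰 𝒟 W'}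
    {x₀ x₀' : EuclideanSpace ℝ (Fin n)}
    {Θ Θ' : Type*} [MeasurableSpace Θ] [MeasurableSpace Θ']
    (real : Sim2Real.ClosedLoop S x₀ Θ) (sim : Sim2Real.ClosedLoop S' x₀' Θ')
    -- the robustness measure
    {ψ : (ℝ≥0 → EuclideanSpace ℝ (Fin n)) → Prop}
    {ρ : (ℝ≥0 → EuclideanSpace ℝ (Fin n)) → ℝ}
    (_hψ : Sim2Real.IsRobustnessMeasure ψ ρ)
    (h_real : Sim2Real.HasExpectedRobustness ρ real)
    (h_sim : Sim2Real.HasExpectedRobustness ρ sim)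
    -- algorithm inputs for the two problems, and the norm bounds on the two objectives
    (p₀ p₁ : Sim2Real.Params 𝒟)
    (hk₀ : Measurable fun q : 𝒟 × 𝒟 => p₀.k q.1 q.2)
    (hk₁ : Measurable fun q : 𝒟 × 𝒟 => p₁.k q.1 q.2)
    (hJ₀ : Sim2Real.RKHSNormLE p₀.k (fun d => -Sim2Real.expRobustness ρ sim d) p₀.B)
    (hJ₁ : Sim2Real.RKHSNormLE p₁.k (fun d => Sim2Real.expGap ρ real sim d) p₁.B)
    -- two independent runs of the algorithm
    {Ω : Type*} [MeasurableSpace Ω] (P : Measure Ω) [IsProbabilityMeasure P]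
    (run₀ : Sim2Real.Run p₀ (fun d => -Sim2Real.expRobustness ρ sim d) P)
    (run₁ : Sim2Real.Run p₁ (fun d => Sim2Real.expGap ρ real sim d) P)
    (h_indep : ProbabilityTheory.IndepFun
      (fun ω (i : ℕ) => (run₀.z i ω, run₀.ξ i ω)) (fun ω (i : ℕ) => (run₁.z i ω, run₁.ξ i ω)) P)
    -- the outputs: `ρhat` is the lower bound for the simulator, `e` the upper bound for the gap
    (ρhat e : Ω → ℝ) (hρhat : ∀ ω, ρhat ω = -run₀.output ω) (he : ∀ ω, e ω = run₁.output ω) :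
    -- termination
    (Sim2Real.InfoGainGrowth p₀.k → BddAbove (Set.range p₀.reg) → ∀ ω, run₀.Terminates ω) ∧
    (Sim2Real.InfoGainGrowth p₁.k → BddAbove (Set.range p₁.reg) → ∀ ω, run₁.Terminates ω) ∧
    -- the two bounds at termination
    ENNReal.ofReal ((1 - p₀.δ) * (1 - p₁.δ)) ≤
      P {ω | run₀.Terminates ω → run₁.Terminates ω →
        ρhat ω - e ω ≤ Sim2Real.minExpRobustness ρ real} ∧
    ENNReal.ofReal ((1 - p₀.δ) * (1 - p₁.δ)) ≤
      P {ω | run₀.Terminates ω → run₁.Terminates ω →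
        |Sim2Real.minExpRobustness ρ real - (ρhat ω - e ω)| ≤ 2 * e ω + p₀.ε + p₁.ε} := by

  obtain ⟨G₀, hG₀, hP₀, hspec₀⟩ := run₀.exists_measurableSet_output_spec hk₀ hJ₀
  obtain ⟨G₁, hG₁, hP₁, hspec₁⟩ := run₁.exists_measurableSet_output_spec hk₁ hJ₁
  -- For the gap only the upper bound property of the second output is used; its near-attainment is
  -- not.
  have hbounds : ∀ ω, (∀ a, -Sim2Real.expRobustness ρ sim a ≤ run₀.output ω) →
      (∃ a, run₀.output ω ≤ -Sim2Real.expRobustness ρ sim a + p₀.ε) →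
      (∀ a, Sim2Real.expGap ρ real sim a ≤ run₁.output ω) →
      Sim2Real.minExpRobustness ρ real ∈
        Set.Icc (ρhat ω - e ω) (ρhat ω + p₀.ε + e ω) ∧ 0 ≤ e ω := by
    rintro ω h1 ⟨d, h2⟩ h3
    rw [hρhat, he]
    exact ⟨Sim2Real.minExpRobustness_mem_Icc h_real h_sim (fun d => neg_le.1 (h1 d))
      ⟨d, by linarith⟩ h3, (Sim2Real.expGap_nonneg ρ real sim d).trans (h3 d)⟩
  refine ⟨run₀.terminates_of_infoGainGrowth hJ₀, run₁.terminates_of_infoGainGrowth hJ₁,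
    Sim2Real.ofReal_mul_le_measure_of_indepFun h_indep hG₀ hG₁ (sub_nonneg.2 p₀.δ_le_one)
      hP₀ hP₁ ?_,
    Sim2Real.ofReal_mul_le_measure_of_indepFun h_indep hG₀ hG₁ (sub_nonneg.2 p₀.δ_le_one)
      hP₀ hP₁ ?_⟩
  · filter_upwards [hspec₀, hspec₁] with ω hs₀ hs₁ hω₀ hω₁ ht₀ ht₁
    obtain ⟨h1, h2⟩ := hs₀ hω₀ ht₀
    exact (hbounds ω h1 h2 (hs₁ hω₁ ht₁).1).1.1
  · filter_upwards [hspec₀, hspec₁] with ω hs₀ hs₁ hω₀ hω₁ ht₀ ht₁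
    obtain ⟨h1, h2⟩ := hs₀ hω₀ ht₀
    obtain ⟨h3, h4⟩ := hbounds ω h1 h2 (hs₁ hω₁ ht₁).1
    have := p₀.ε_pos
    have := p₁.ε_pos
    -- The interval gives `0 ≤ ρ* - ρᵉ ≤ 2 e + ε₀`, and `e ≥ 0` makes the lower half of the absolute
    -- value trivial; `ε₁` is slack.
    rw [abs_le]
    constructor <;> linarith [h3.1, h3.2]
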